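/- Let $X = X_1\times\dots\times X_b$, where $X_i\subseteq\mathbb R^{n_i}$ are nonempty, closed, convex and bounded, $\mathbb R^{n_i}$ carries a norm $\|\cdot\|_i$ with conjugate norm $\|\cdot\|_{i,*}$, and $\|x\|^2=\sum_{i=1}^b\|x^{(i)}\|_i^2$ for $x=(x^{(1)},\dots,x^{(b)})$. Let $\omega_i:X_i\to\mathbb R$ be continuously differentiable with $\langle x-z,\nabla\omega_i(x)-\nabla\omega_i(z)\rangle\ge\|x-z\|_i^2$ for all $x,z\in X_i$, and put $$V_i(z,x)=\omega_i(x)-[\omega_i(z)+\langle\nabla\omega_i(z),x-z\rangle],\qquad \mathcal D_i=\max_{X_i}\omega_i-\min_{X_i}\omega_i,$$ $$P_i(v,y,\gamma)=\operatorname*{argmin}_{u\in X_i}\ \langle y,u\rangle+\tfrac1\gamma V_i(v,u).$$ Let $f:X\to\mathbb R$ be convex, $\xi$ a random variable, and $G(x,\xi)=(G_1(x,\xi),\dots,G_b(x,\xi))$ a stochastic subgradient: $\mathbb E[G(x,\xi)]=g(x)\in\partial f(x)$ for all $x\in X$. Suppose that, for constants $M_i>0$, $$\mathbb E\left\{\exp\left[\|G_i(x,\xi)\|_{i,*}^2/M_i^2\right]\right\}\le\exp(1),\qquad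 i=1,\dots,b,\ x\in X,$$ and let $\bar M=\max_i M_i$. SBMD algorithm. Given $N\ge1$, $x_1\in X$, stepsizes $\gamma_k>0$ and weights $\theta_k$, set $s_1=0$ and $u_i=1$ for all $i$. For $k=1,\dots,N$: draw $i_k$ uniformly from $\{1,\dots,b\}$ and a copy $\xi_k$ of $\xi$, all the draws $i_1,\xi_1,\dots,i_N,\xi_N$ being independent; put $s_{k+1}^{(i_k)}=s_k^{(i_k)}+x_k^{(i_k)}\sum_{j=u_{i_k}}^k\theta_j$, then set $u_{i_k}=k+1$; put $x_{k+1}^{(i_k)}=P_{i_k}(x_k^{(i_k)},G_{i_k}(x_k,\xi_k),\gamma_k)$; leave all other blocks of $s_k$ and $x_k$ unchanged. The output is $\bar x_N$ with blocks $\bar x_N^{(i)}=\left(\sum_{k=1}^N\theta_k\right)^{-1}\left(s_{N+1}^{(i)}+x_N^{(i)}\sum_{j=u_i}^N\theta_j\right)$. a) If $\theta_k=\gamma_k$ for $k=1,\dots,N$, then for any $x\in X$ and $\lambda>0$, $$\mathrm{Prob}\left\{f(\bar x_N)-f(x)\ge b\Big(\sum_{k=1}^N\gamma_k\Big)^{-1}\Big[\sum_{i=1}^bV_i(x_1^{(i)},x^{(i)})+\bar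 M^2\sum_{k=1}^N\gamma_k^2+\lambda\Big(\bar M^2\sum_{k=1}^N\gamma_k^2+\bar M\sqrt{32\sum_{i=1}^b\mathcal D_i}\sqrt{\sum_{k=1}^N\gamma_k^2}\Big)\Big]\right\}\le\exp(-\lambda^2/3)+\exp(-\lambda).$$ b) Let $\mu,Q>0$ be such that $f(y)\ge f(x)+\langle g(x),y-x\rangle+\frac\mu2\|y-x\|^2$ for all $x,y\in X$ and $V_i(z,x)\le\frac Q2\|z-x\|_i^2$ for all $i$ and all $z,x\in X_i$. Suppose that $\gamma_k\le bQ/\mu$ for $k=1,\dots,N$, and that $\theta_k=\gamma_k/\Gamma_k$ for $k=1,\dots,N$, where $\Gamma_1=1$, $\Gamma_k=\Gamma_{k-1}\left(1-\frac{\gamma_k\mu}{bQ}\right)$ for $k\ge2$, and $\Gamma_k>0$ for $k=1,\dots,N$. Then for any $x\in X$ and $\lambda>0$, $$\mathrm{Prob}\left\{f(\bar x_N)-f(x)\ge b\Big(\sum_{k=1}^N\theta_k\Big)^{-1}\Big[\Big(b-\frac{\gamma_1\mu}Q\Big)\sum_{i=1}^bV_i(x_1^{(i)},x^{(i)})+\bar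 M^2\sum_{k=1}^N\gamma_k\theta_k+\lambda\Big(\bar M^2\sum_{k=1}^N\gamma_k\theta_k+\bar M\sqrt{32\sum_{i=1}^b\mathcal D_i}\sqrt{\sum_{k=1}^N\theta_k^2}\Big)\Big]\right\}\le\exp(-\lambda^2/3)+\exp(-\lambda).$$ -/

import Mathlib

open MeasureTheory ProbabilityTheory

noncomputable section

namespace SBMD

section Block

variable {E : Type*} [NormedAddCommGroup E] [NormedSpace ℝ E]

/-- `w` is a distance generating function on `X` with modulus `1` with respect to the norm of `E`,
and `dw` is its (continuous) derivative on `X`.  The dual space carries the conjugate norm.  If `X`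
has empty interior, `dw z` is determined only in the directions of `X`; these are the only ones
that enter the prox-function. -/
structure IsDistanceGenerating (X : Set E) (w : E → ℝ) (dw : E → StrongDual ℝ E) : Prop where
  hasDeriv : ∀ z ∈ X, HasFDerivWithinAt w (dw z) X z
  continuousOn_deriv : ContinuousOn dw X
  strong : ∀ x ∈ X, ∀ z ∈ X, ‖x - z‖ ^ 2 ≤ (dw x - dw z) (x - z)

/-- The prox-function (Bregman distance) `V(z, x)`, with centre `z`. -/
def prox (w : E → ℝ) (dw : E → StrongDual ℝ E) (z x : E) : ℝ :=
  w x - (w z + dw z (x - z))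

/-- The prox-mapping: a minimizer over `u ∈ X` of `⟨y, u⟩ + V(v, u) / γ`. -/
def proxMap (X : Set E) (w : E → ℝ) (dw : E → StrongDual ℝ E)
    (v : E) (y : StrongDual ℝ E) (γ : ℝ) : E :=
  Classical.epsilon fun u => u ∈ X ∧ IsMinOn (fun u' => y u' + 1 / γ * prox w dw v u') X u

/-- `max_X w - min_X w`. -/
def spread (X : Set E) (w : E → ℝ) : ℝ :=
  sSup (w '' X) - sInf (w '' X)

end Block

section Algorithm

variable {b : ℕ} {E : Fin b → Type*} [∀ i, NormedAddCommGroup (E i)] [∀ i, NormedSpace ℝ (E i)]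
  {Ξ : Type*}

/-- The pairing `⟨y, x⟩` of a dual vector with a vector, both given by their blocks. -/
def pairing (y : ∀ i, StrongDual ℝ (E i)) (x : ∀ i, E i) : ℝ :=
  ∑ i, y i (x i)

/-- The variables kept by the algorithm: search point, weighted sum, and for each block the first
index whose weight is not yet included in the sum. -/
structure State (E : Fin b → Type*) where
  x : ∀ i, E i
  s : ∀ i, E i
  u : Fin b → ℕ

/-- Iteration `k`, with random block `j` and random sample `z`. -/
def step (X : ∀ i, Set (E i)) (w : ∀ i, E i → ℝ) (dw : ∀ i, E i → StrongDual ℝ (E i))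
    (G : (∀ i, E i) → Ξ → ∀ i, StrongDual ℝ (E i)) (γ θ : ℕ → ℝ)
    (k : ℕ) (j : Fin b) (z : Ξ) (st : State E) : State E where
  x := Function.update st.x j (proxMap (X j) (w j) (dw j) (st.x j) (G st.x z j) (γ k))
  s := Function.update st.s j (st.s j + (∑ l ∈ Finset.Icc (st.u j) k, θ l) • st.x j)
  u := Function.update st.u j (k + 1)

/-- `run … k` is the state after iterations `1, …, k`; its search point is `x_{k+1}`. -/
def run (X : ∀ i, Set (E i)) (w : ∀ i, E i → ℝ) (dw : ∀ i, E i → StrongDual ℝ (E i))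
    (G : (∀ i, E i) → Ξ → ∀ i, StrongDual ℝ (E i)) (γ θ : ℕ → ℝ)
    (x₁ : ∀ i, E i) (blk : ℕ → Fin b) (ξ : ℕ → Ξ) : ℕ → State E
  | 0 => ⟨x₁, 0, fun _ => 1⟩
  | k + 1 => step X w dw G γ θ (k + 1) (blk (k + 1)) (ξ (k + 1))
      (run X w dw G γ θ x₁ blk ξ k)

/-- The output of the stochastic block mirror descent algorithm after `N ≥ 1` iterations. -/
def output (X : ∀ i, Set (E i)) (w : ∀ i, E i → ℝ) (dw : ∀ i, E i → StrongDual ℝ (E i))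
    (G : (∀ i, E i) → Ξ → ∀ i, StrongDual ℝ (E i)) (γ θ : ℕ → ℝ)
    (x₁ : ∀ i, E i) (N : ℕ) (blk : ℕ → Fin b) (ξ : ℕ → Ξ) : ∀ i, E i := fun i =>
  (∑ k ∈ Finset.Icc 1 N, θ k)⁻¹ •
    ((run X w dw G γ θ x₁ blk ξ N).s i +
      (∑ l ∈ Finset.Icc ((run X w dw G γ θ x₁ blk ξ N).u i) N, θ l) •
        (run X w dw G γ θ x₁ blk ξ (N - 1)).x i)

/-- `G` is a stochastic oracle on `X = ∏ X i` for `f`, with samples of law `ν`: it is measurable,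
and `E[G(x, ξ)] = g(x) ∈ ∂f(x)` for all `x ∈ X`. -/
structure IsStochasticSubgradient [∀ i, MeasurableSpace (E i)] [MeasurableSpace Ξ]
    (X : ∀ i, Set (E i)) (f : (∀ i, E i) → ℝ) (g : (∀ i, E i) → ∀ i, StrongDual ℝ (E i))
    (G : (∀ i, E i) → Ξ → ∀ i, StrongDual ℝ (E i)) (ν : Measure Ξ) : Prop where
  measurable : ∀ i, Measurable fun p : (∀ i, E i) × Ξ => G p.1 p.2 i
  integrable : ∀ x ∈ Set.univ.pi X, ∀ i, Integrable (fun z => G x z i) ν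
  unbiased : ∀ x ∈ Set.univ.pi X, ∀ i, ∫ z, G x z i ∂ν = g x i
  subgradient : ∀ x ∈ Set.univ.pi X, ∀ y ∈ Set.univ.pi X, f x + pairing (g x) (y - x) ≤ f y

/-- The light-tail condition `E exp(‖G_i(x, ξ)‖² / M_i²) ≤ e` for all `x ∈ X` and all `i`. -/
def LightTail [MeasurableSpace Ξ] (X : ∀ i, Set (E i))
    (G : (∀ i, E i) → Ξ → ∀ i, StrongDual ℝ (E i)) (ν : Measure Ξ) (M : Fin b → ℝ) : Prop :=
  ∀ x ∈ Set.univ.pi X, ∀ i,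
    ∫⁻ z, ENNReal.ofReal (Real.exp (‖G x z i‖ ^ 2 / M i ^ 2)) ∂ν ≤ ENNReal.ofReal (Real.exp 1)

/-- `f` is strongly convex on `X` with parameter `μ`, for the selection `g` of subgradients and the
norm `‖x‖² = ∑ ‖x i‖²`. -/
def IsStronglyConvex (X : ∀ i, Set (E i)) (f : (∀ i, E i) → ℝ)
    (g : (∀ i, E i) → ∀ i, StrongDual ℝ (E i)) (μ : ℝ) : Prop :=
  ∀ x ∈ Set.univ.pi X, ∀ y ∈ Set.univ.pi X,
    f x + pairing (g x) (y - x) + μ / 2 * ∑ i, ‖y i - x i‖ ^ 2 ≤ f y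

/-- The blocks and samples `(i_k, ξ_k)`, `k = 1, …, N`, drawn by the algorithm: independent over
`k`, with `i_k` uniform, `ξ_k` of law `ν`, and `i_k` independent of `ξ_k`. -/
structure IsUniformSampling {Ω : Type*} [MeasurableSpace Ω] [MeasurableSpace Ξ]
    (P : Measure Ω) (ν : Measure Ξ) (N : ℕ) (blk : ℕ → Ω → Fin b) (ξ : ℕ → Ω → Ξ) : Prop where
  measurable_blk : ∀ k ∈ Finset.Icc 1 N, Measurable (blk k)
  measurable_sample : ∀ k ∈ Finset.Icc 1 N, Measurable (ξ k)
  uniform : ∀ k ∈ Finset.Icc 1 N, ∀ j : Fin b, P.real {ω | blk k ω = j} = 1 / b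
  law : ∀ k ∈ Finset.Icc 1 N, P.map (ξ k) = ν
  indep_pair : ∀ k ∈ Finset.Icc 1 N, IndepFun (blk k) (ξ k) P
  indep : iIndepFun (fun (k : Finset.Icc 1 N) (ω : Ω) => (blk k ω, ξ k ω)) P

end Algorithm

/-- `Γ_1 = 1` and `Γ_k = Γ_{k-1} (1 - γ_k μ / (b Q))` for `k ≥ 2` (`Γ_0` is not used). -/
def Gam (b : ℕ) (μ Q : ℝ) (γ : ℕ → ℝ) : ℕ → ℝ
  | 0 => 1
  | 1 => 1
  | k + 2 => Gam b μ Q γ (k + 1) * (1 - γ (k + 2) * μ / (b * Q))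

end SBMD

end

/-! Each iteration obeys the mirror descent inequality V_{k+1} ≤ V_k - γ_k z_k + γ_k² ‖G_j‖² / 2,
where V_k is the total prox-function towards the comparison point y and z_k = ⟨G_j, x_j - y_j⟩ is
the slope in the sampled block j. Given the past, z_k has mean ⟨g(x_k), x_k - y⟩ / b (the origin of
the factor b), and (strong) convexity bounds this pairing below by f(x_k) - f(y) + κ V_k. Dividing
by Γ_k makes the inequalities telescope. The output is the θ-weighted mean of x_1, …, x_N, so
Jensen's inequality bounds its gap pathwise by b / ∑ θ_k times the sum of a deterministic term, the
noise M̄² A / 2 with A = ∑ γ_k θ_k a_k and a_k = ‖G_j‖² / M̄², and the martingale B = ∑ θ_k (E z_k -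
z_k) (`output_gap_le`).

For A no independence is needed: `exp` is convex, so the normalized sum inherits E exp a ≤ e, and
Chernoff's bound gives exp(-λ). For B, z_k² ≤ r² a_k with r² = 8 M̄² ∑ D_i. By
`lintegral_exp_centered_le` each centered slope then has exponential moments at most exp(3 t² r²),
these multiply along the recursion, and Chernoff's bound gives exp(-λ²/3).

To make conditioning rigorous, the iterates are viewed as a measurable recursion on the feasible set
driven by i.i.d. pairs; the current state is independent of the next pair, and Tonelli's theorem
replaces conditional expectation. Both claims are instances of `measureReal_output_gap_ge_le`: κ =
0, Γ = 1 for a), κ = μ / Q for b). -/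

namespace SBMD

/-! ### Geometry of one block: prox-function, diameter and prox-mapping. -/

section Block

variable {E : Type*} [NormedAddCommGroup E] [NormedSpace ℝ E]
  {X : Set E} {w : E → ℝ} {dw : E → StrongDual ℝ E}

theorem IsDistanceGenerating.continuousOn (h : IsDistanceGenerating X w dw) : ContinuousOn w X :=
  fun z hz => (h.hasDeriv z hz).continuousWithinAt

/-- A distance generating function is strongly convex with modulus `1`. -/
theorem IsDistanceGenerating.half_sq_le_prox (h : IsDistanceGenerating X w dw) (hX : Convex ℝ X)
    {x z : E} (hx : x ∈ X) (hz : z ∈ X) : 1 / 2 * ‖x - z‖ ^ 2 ≤ prox w dw z x := by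
  have hmem : ∀ t ∈ Set.Icc (0 : ℝ) 1, z + t • (x - z) ∈ X := fun t ht =>
    hX.add_smul_sub_mem hz hx ht
  -- Strong monotonicity of `dw` between z + t(x - z) and z says that t φ'(t) ≥ 0; the claim is then
  -- φ 0 ≤ φ 1.
  set φ : ℝ → ℝ := fun t => w (z + t • (x - z)) - t * dw z (x - z) - t ^ 2 / 2 * ‖x - z‖ ^ 2
    with hφ
  have hderiv : ∀ t ∈ Set.Icc (0 : ℝ) 1, HasDerivWithinAt φ
      (dw (z + t • (x - z)) (x - z) - dw z (x - z) - t * ‖x - z‖ ^ 2) (Set.Icc 0 1) t := by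
    intro t ht
    have hline : HasDerivWithinAt (fun t : ℝ => z + t • (x - z)) (x - z) (Set.Icc 0 1) t := by
      simpa using (((hasDerivAt_id t).smul_const (x - z)).const_add z).hasDerivWithinAt
    have h1 := (h.hasDeriv _ (hmem t ht)).comp_hasDerivWithinAt t hline hmem
    have h2 : HasDerivWithinAt (fun t : ℝ => t * dw z (x - z)) (dw z (x - z)) (Set.Icc 0 1) t := by
      simpa using ((hasDerivAt_id t).mul_const (dw z (x - z))).hasDerivWithinAt
    have h3 : HasDerivWithinAt (fun t : ℝ => t ^ 2 / 2 * ‖x - z‖ ^ 2) (t * ‖x - z‖ ^ 2)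
        (Set.Icc 0 1) t := by
      refine (((hasDerivAt_pow 2 t).div_const 2).mul_const (‖x - z‖ ^ 2)).hasDerivWithinAt.congr_deriv
        ?_
      norm_num
    exact (h1.sub h2).sub h3
  have hmono : MonotoneOn φ (Set.Icc 0 1) := by
    refine monotoneOn_of_hasDerivWithinAt_nonneg (convex_Icc 0 1)
      (fun t ht => (hderiv t ht).continuousWithinAt)
      (fun t ht => (hderiv t (interior_subset ht)).mono interior_subset) fun t ht => ?_
    rw [interior_Icc] at ht
    have hs := h.strong _ (hmem t ⟨ht.1.le, ht.2.le⟩) z hz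
    rw [add_sub_cancel_left, map_smul, norm_smul, Real.norm_of_nonneg ht.1.le, mul_pow,
      smul_eq_mul, sub_eq_add_neg (dw _) (dw z), add_apply,
      neg_apply] at hs
    have : t * (t * ‖x - z‖ ^ 2) ≤ t * (dw (z + t • (x - z)) (x - z) - dw z (x - z)) := by
      linarith
    have := le_of_mul_le_mul_left this ht.1
    linarith
  have := hmono (Set.left_mem_Icc.2 zero_le_one) (Set.right_mem_Icc.2 zero_le_one) zero_le_one
  simp only [hφ, zero_smul, add_zero, one_smul, add_sub_cancel] at this
  unfold prox
  linarith

theorem IsDistanceGenerating.prox_nonneg (h : IsDistanceGenerating X w dw) (hX : Convex ℝ X)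
    {x z : E} (hx : x ∈ X) (hz : z ∈ X) : 0 ≤ prox w dw z x :=
  le_trans (by positivity) (h.half_sq_le_prox hX hx hz)

/-- Adding the strong convexity inequalities centred at the midpoint cancels the linear terms and
leaves ‖x - z‖² / 4 ≤ w x + w z - 2 w(mid) ≤ 2 · spread. -/
theorem IsDistanceGenerating.sq_norm_sub_le_spread (h : IsDistanceGenerating X w dw)
    (hX : Convex ℝ X) (hc : IsCompact X) {x z : E} (hx : x ∈ X) (hz : z ∈ X) :
    ‖x - z‖ ^ 2 ≤ 8 * spread X w := by
  have hm : midpoint ℝ x z ∈ X := hX.midpoint_mem hx hz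
  have h1 := h.half_sq_le_prox hX hx hm
  have h2 := h.half_sq_le_prox hX hz hm
  have e1 : x - midpoint ℝ x z = (1 / 2 : ℝ) • (x - z) := by
    rw [left_sub_midpoint]; norm_num
  have e2 : z - midpoint ℝ x z = -((1 / 2 : ℝ) • (x - z)) := by
    rw [right_sub_midpoint, ← smul_neg, neg_sub]; norm_num
  have hcw := hc.image_of_continuousOn h.continuousOn
  have hle : ∀ y ∈ X, w y ≤ sSup (w '' X) := fun y hy =>
    le_csSup hcw.bddAbove (Set.mem_image_of_mem w hy)
  have hge : sInf (w '' X) ≤ w (midpoint ℝ x z) :=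
    csInf_le hcw.bddBelow (Set.mem_image_of_mem w hm)
  unfold prox at h1 h2
  rw [e1, norm_smul] at h1
  rw [e2, norm_neg, norm_smul, map_neg] at h2
  have e3 : (‖(1 / 2 : ℝ)‖ * ‖x - z‖) ^ 2 = 1 / 4 * ‖x - z‖ ^ 2 := by
    rw [mul_pow]; norm_num
  rw [e3] at h1 h2
  have := hle x hx
  have := hle z hz
  unfold spread
  linarith

theorem IsDistanceGenerating.spread_nonneg (h : IsDistanceGenerating X w dw)
    (hX : Convex ℝ X) (hc : IsCompact X) (hne : X.Nonempty) : 0 ≤ spread X w := by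
  obtain ⟨x, hx⟩ := hne
  simpa using h.sq_norm_sub_le_spread hX hc hx hx

/-- A minimizer over `X` of `w` plus a linear functional. -/
noncomputable def tiltedArgmin (X : Set E) (w : E → ℝ) (l : StrongDual ℝ E) : E :=
  Classical.epsilon fun u => u ∈ X ∧ IsMinOn (fun u' => w u' + l u') X u

theorem IsDistanceGenerating.tiltedArgmin_spec (h : IsDistanceGenerating X w dw)
    (hc : IsCompact X) (hne : X.Nonempty) (l : StrongDual ℝ E) :
    tiltedArgmin X w l ∈ X ∧ IsMinOn (fun u' => w u' + l u') X (tiltedArgmin X w l) :=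
  Classical.epsilon_spec
    (hc.exists_isMinOn hne (h.continuousOn.add l.continuous.continuousOn))

theorem IsDistanceGenerating.tiltedArgmin_variational (h : IsDistanceGenerating X w dw)
    (hX : Convex ℝ X) (hc : IsCompact X) (l : StrongDual ℝ E) {x : E} (hx : x ∈ X) :
    0 ≤ (dw (tiltedArgmin X w l) + l) (x - tiltedArgmin X w l) := by
  obtain ⟨hu, hmin⟩ := h.tiltedArgmin_spec hc ⟨x, hx⟩ l
  exact IsLocalMinOn.hasFDerivWithinAt_nonneg hmin.localize
    ((h.hasDeriv _ hu).add l.hasFDerivWithinAt)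
    (sub_mem_posTangentConeAt_of_segment_subset (hX.segment_subset hu hx))

/-- Testing each variational inequality at the other minimizer and adding gives ‖u - v‖² ≤ (m - l)(u
- v). This continuity makes the iterates measurable. -/
theorem IsDistanceGenerating.lipschitzWith_tiltedArgmin (h : IsDistanceGenerating X w dw)
    (hX : Convex ℝ X) (hc : IsCompact X) (hne : X.Nonempty) :
    LipschitzWith 1 (tiltedArgmin X w) := by
  refine LipschitzWith.of_dist_le_mul fun l m => ?_
  obtain ⟨hu, -⟩ := h.tiltedArgmin_spec hc hne l
  obtain ⟨hv, -⟩ := h.tiltedArgmin_spec hc hne m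
  have h1 := h.tiltedArgmin_variational hX hc l hv
  have h2 := h.tiltedArgmin_variational hX hc m hu
  have h3 := h.strong _ hu _ hv
  set u := tiltedArgmin X w l
  set v := tiltedArgmin X w m
  rw [dist_eq_norm, dist_eq_norm, NNReal.coe_one, one_mul]
  have h4 : (m - l) (u - v) ≤ ‖l - m‖ * ‖u - v‖ :=
    (le_abs_self _).trans (by rw [norm_sub_rev l m]; exact (m - l).le_opNorm (u - v))
  simp only [add_apply, sub_eq_add_neg (dw _), neg_apply,
    sub_eq_add_neg m, map_sub] at h1 h2 h3 h4
  have h5 : ‖u - v‖ * ‖u - v‖ ≤ ‖l - m‖ * ‖u - v‖ := by nlinarith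
  rcases (norm_nonneg (u - v)).eq_or_lt with h0 | h0
  · rw [← h0]; positivity
  · exact le_of_mul_le_mul_right h5 h0

/-- Up to the factor γ and an additive constant the two objectives agree. The predicates under
`Classical.epsilon` are therefore equal, so the same minimizer is chosen. -/
theorem proxMap_eq_tiltedArgmin (X : Set E) (w : E → ℝ) (dw : E → StrongDual ℝ E) (v : E)
    (y : StrongDual ℝ E) {γ : ℝ} (hγ : 0 < γ) :
    proxMap X w dw v y γ = tiltedArgmin X w (γ • y - dw v) := by
  unfold proxMap tiltedArgmin
  have e : ∀ a, γ * (y a + 1 / γ * prox w dw v a)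
      = w a + (γ • y - dw v) a + (dw v v - w v) := by
    intro a
    simp only [prox, sub_eq_add_neg (γ • y), add_apply,
      neg_apply, smul_apply, smul_eq_mul, map_sub]
    field_simp
    ring
  have key : ∀ a c, y a + 1 / γ * prox w dw v a ≤ y c + 1 / γ * prox w dw v c ↔
      w a + (γ • y - dw v) a ≤ w c + (γ • y - dw v) c := fun a c => by
    rw [← mul_le_mul_iff_right₀ hγ, e, e, add_le_add_iff_right]
  congr 1
  ext u
  exact and_congr_right fun _ => forall₂_congr fun u' _ => key u u'

theorem IsDistanceGenerating.proxMap_mem (h : IsDistanceGenerating X w dw) (hc : IsCompact X)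
    {v : E} (hv : v ∈ X) (y : StrongDual ℝ E) {γ : ℝ} (hγ : 0 < γ) :
    proxMap X w dw v y γ ∈ X := by
  rw [proxMap_eq_tiltedArgmin X w dw v y hγ]
  exact (h.tiltedArgmin_spec hc ⟨v, hv⟩ _).1

/-- The basic inequality for one prox step. -/
theorem IsDistanceGenerating.prox_proxMap_le (h : IsDistanceGenerating X w dw) (hX : Convex ℝ X)
    (hc : IsCompact X) {v x : E} (hv : v ∈ X) (hx : x ∈ X) (y : StrongDual ℝ E) {γ : ℝ}
    (hγ : 0 < γ) :
    prox w dw (proxMap X w dw v y γ) x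
      ≤ prox w dw v x - γ * y (v - x) + 1 / 2 * γ ^ 2 * ‖y‖ ^ 2 := by
  have hu := h.proxMap_mem hc hv y hγ
  have h1 := h.tiltedArgmin_variational hX hc (γ • y - dw v) hx
  rw [← proxMap_eq_tiltedArgmin X w dw v y hγ] at h1
  set u := proxMap X w dw v y γ
  have h2 := h.half_sq_le_prox hX hu hv
  have h3 : y (v - u) ≤ ‖y‖ * ‖u - v‖ :=
    (le_abs_self _).trans (by rw [norm_sub_rev u v]; exact y.le_opNorm (v - u))
  have h4 : γ * y (v - u) ≤ γ * (‖y‖ * ‖u - v‖) := mul_le_mul_of_nonneg_left h3 hγ.le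
  -- Young's inequality: the term ‖u - v‖² / 2 supplied by V(v, u) absorbs γ ‖y‖ ‖u - v‖.
  have h5 := sq_nonneg (γ * ‖y‖ - ‖u - v‖)
  simp only [prox, sub_eq_add_neg (γ • y), add_apply,
      neg_apply, smul_apply, smul_eq_mul, map_sub]
      at h1 h2 h4 ⊢
  nlinarith

end Block

/-! ### Exponential moments of one centered increment. -/

section Exponential

/-- The constant 3/4 is what leads to 3 t² r² below. For x ≤ 0, exp x ≤ 1 + x + x²/2; on [0, 1]
Taylor's bound has quadratic coefficient 1/2 + 2/9 < 3/4; for x ≥ 4/3 already x ≤ 3x²/4. On [1,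
4/3], with d = x - 3x²/4 ≤ 1/4, the difference of the exponentials is at most d exp x ≤ 4/4 ≤ x. -/
theorem exp_le_add_exp_sq (x : ℝ) : Real.exp x ≤ x + Real.exp (3 / 4 * x ^ 2) := by
  have hq := Real.add_one_le_exp (3 / 4 * x ^ 2)
  rcases le_total x 0 with h0 | h0
  · have h1 := Real.quadratic_le_exp_of_nonneg (neg_nonneg.2 h0)
    have h2 : Real.exp x ≤ 1 + x + x ^ 2 / 2 := by
      have h3 : Real.exp x * Real.exp (-x) = 1 := by rw [← Real.exp_add]; simp
      have h4 := mul_le_mul_of_nonneg_left h1 (Real.exp_pos x).le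
      rw [h3] at h4
      have h5 : 0 < 1 + -x + (-x) ^ 2 / 2 := by nlinarith [sq_nonneg x]
      refine le_of_mul_le_mul_right (h4.trans ?_) h5
      nlinarith [sq_nonneg (x ^ 2)]
    nlinarith [sq_nonneg x]
  rcases le_total x 1 with h1 | h1
  · have h2 := Real.exp_bound' h0 h1 (n := 3) (by norm_num)
    norm_num [Finset.sum_range_succ, Nat.factorial] at h2
    have h3 : x ^ 3 ≤ x ^ 2 := pow_le_pow_of_le_one h0 h1 (by norm_num)
    nlinarith
  rcases le_total (4 / 3) x with h2 | h2
  · have : Real.exp x ≤ Real.exp (3 / 4 * x ^ 2) := Real.exp_le_exp.2 (by nlinarith)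
    linarith
  · set d := x - 3 / 4 * x ^ 2
    have e1 : Real.exp (3 / 4 * x ^ 2) = Real.exp x * Real.exp (-d) := by
      rw [← Real.exp_add]; congr 1; ring
    have h3 := Real.add_one_le_exp (-d)
    have h4 : Real.exp x ≤ 4 := by
      have h5 : Real.exp x ≤ Real.exp (4 / 3) := Real.exp_le_exp.2 h2
      refine h5.trans (le_of_pow_le_pow_left₀ (n := 3) (by norm_num) (by norm_num) ?_)
      rw [← Real.exp_nat_mul]
      have : Real.exp (((3 : ℕ) : ℝ) * (4 / 3)) = Real.exp 1 ^ 4 := by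
        rw [← Real.exp_nat_mul]; norm_num
      rw [this]
      exact (pow_le_pow_left₀ (Real.exp_pos 1).le
        (Real.exp_one_lt_d9.le.trans (by norm_num : (2.7182818286 : ℝ) ≤ 2.8)) 4).trans
          (by norm_num)
    have h5 : Real.exp x * (-d + 1) ≤ Real.exp x * Real.exp (-d) :=
      mul_le_mul_of_nonneg_left h3 (Real.exp_pos x).le
    have h6 : Real.exp x * d ≤ x := by
      rcases le_total d 0 with hd | hd
      · nlinarith [Real.exp_pos x]
      · have : d ≤ 1 / 4 := by simp only [d]; nlinarith
        nlinarith
    rw [e1]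
    linarith

theorem integrable_of_lintegral_ofReal_le {α : Type*} [MeasurableSpace α] {ρ : Measure α}
    {h : α → ℝ} (hm : Measurable h) (h0 : ∀ y, 0 ≤ h y) {c : ℝ} (hc : 0 ≤ c)
    (hle : ∫⁻ y, ENNReal.ofReal (h y) ∂ρ ≤ ENNReal.ofReal c) :
    Integrable h ρ ∧ ∫ y, h y ∂ρ ≤ c := by
  have hi : Integrable h ρ := by
    refine ⟨hm.aestronglyMeasurable, ?_⟩
    rw [hasFiniteIntegral_iff_ofReal (Filter.Eventually.of_forall h0)]
    exact hle.trans_lt ENNReal.ofReal_lt_top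
  refine ⟨hi, ?_⟩
  rw [← ofReal_integral_eq_lintegral_ofReal hi (Filter.Eventually.of_forall h0)] at hle
  exact (ENNReal.ofReal_le_ofReal_iff hc).1 hle

theorem lintegral_ofReal_le_of_integral_le {α : Type*} [MeasurableSpace α] {ρ : Measure α}
    {h h' : α → ℝ} (hle : ∀ y, h y ≤ h' y) (h0 : ∀ y, 0 ≤ h y) (hi : Integrable h' ρ) {c : ℝ}
    (hc : ∫ y, h' y ∂ρ ≤ c) : ∫⁻ y, ENNReal.ofReal (h y) ∂ρ ≤ ENNReal.ofReal c := by
  calc ∫⁻ y, ENNReal.ofReal (h y) ∂ρ ≤ ∫⁻ y, ENNReal.ofReal (h' y) ∂ρ :=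
        lintegral_mono fun y => ENNReal.ofReal_le_ofReal (hle y)
    _ = ENNReal.ofReal (∫ y, h' y ∂ρ) := (ofReal_integral_eq_lintegral_ofReal hi
        (Filter.Eventually.of_forall fun y => (h0 y).trans (hle y))).symm
    _ ≤ _ := ENNReal.ofReal_le_ofReal hc

variable {α : Type*} [MeasurableSpace α] {ρ : Measure α} [IsProbabilityMeasure ρ] {Z a : α → ℝ}
  {r : ℝ}

omit [IsProbabilityMeasure ρ] in
-- Everything follows from a ≤ exp(a - 1).
theorem integral_le_one_of_exp (ha : Measurable a) (ha0 : ∀ y, 0 ≤ a y)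
    (hae : ∫⁻ y, ENNReal.ofReal (Real.exp (a y)) ∂ρ ≤ ENNReal.ofReal (Real.exp 1)) :
    Integrable a ρ ∧ ∫ y, a y ∂ρ ≤ 1 ∧ Integrable (fun y => Real.exp (a y - 1)) ρ ∧
      ∫ y, Real.exp (a y - 1) ∂ρ ≤ 1 := by
  obtain ⟨hi, hle⟩ := integrable_of_lintegral_ofReal_le (Real.measurable_exp.comp ha)
    (fun y => (Real.exp_pos _).le) (Real.exp_pos 1).le hae
  have e : (fun y => Real.exp (a y - 1)) = fun y => Real.exp (a y) / Real.exp 1 := by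
    ext y; rw [Real.exp_sub]
  have hi' : Integrable (fun y => Real.exp (a y - 1)) ρ := by
    rw [e]; exact hi.div_const _
  have hle' : ∫ y, Real.exp (a y - 1) ∂ρ ≤ 1 := by
    rw [e, integral_div, div_le_one (Real.exp_pos 1)]; exact hle
  have hae : ∀ y, a y ≤ Real.exp (a y - 1) := fun y => by
    have := Real.add_one_le_exp (a y - 1); linarith
  have hai : Integrable a ρ := hi'.mono' ha.aestronglyMeasurable
    (Filter.Eventually.of_forall fun y => by
      rw [Real.norm_of_nonneg (ha0 y)]; exact hae y)
  exact ⟨hai, (integral_mono hai hi' hae).trans hle', hi', hle'⟩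

theorem integral_sq_le_of_exp (hZ : Measurable Z) (ha : Measurable a) (ha0 : ∀ y, 0 ≤ a y)
    (hZa : ∀ y, Z y ^ 2 ≤ r ^ 2 * a y)
    (hae : ∫⁻ y, ENNReal.ofReal (Real.exp (a y)) ∂ρ ≤ ENNReal.ofReal (Real.exp 1)) :
    Integrable Z ρ ∧ (∫ y, Z y ∂ρ) ^ 2 ≤ r ^ 2 := by
  obtain ⟨hai, ha1, -, -⟩ := integral_le_one_of_exp ha ha0 hae
  have hZ2 : Integrable (fun y => Z y ^ 2) ρ :=
    (hai.const_mul (r ^ 2)).mono' (hZ.pow_const 2).aestronglyMeasurable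
      (Filter.Eventually.of_forall fun y => by
        rw [Real.norm_of_nonneg (sq_nonneg _)]; exact hZa y)
  have hZi : Integrable Z ρ := by
    refine (hZ2.add (integrable_const 1)).mono' hZ.aestronglyMeasurable
      (Filter.Eventually.of_forall fun y => ?_)
    rw [Real.norm_eq_abs, Pi.add_apply, ← sq_abs]
    nlinarith [sq_nonneg (|Z y| - 1), abs_nonneg (Z y)]
  refine ⟨hZi, ?_⟩
  set m := ∫ y, Z y ∂ρ
  -- Integrating (Z - m)² ≥ 0 gives m² ≤ E Z² ≤ r² E a.
  have h1 : ∫ y, (2 * m * Z y - m ^ 2) ∂ρ ≤ ∫ y, r ^ 2 * a y ∂ρ :=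
    integral_mono ((hZi.const_mul _).sub (integrable_const _)) (hai.const_mul _) fun y => by
      have := hZa y
      have := sq_nonneg (Z y - m)
      dsimp only
      linarith
  rw [integral_sub (hZi.const_mul _) (integrable_const _), integral_const_mul, integral_const_mul,
    integral_const, probReal_univ, one_smul] at h1
  have h2 : r ^ 2 * ∫ y, a y ∂ρ ≤ r ^ 2 * 1 := mul_le_mul_of_nonneg_left ha1 (sq_nonneg r)
  change 2 * m * m - m ^ 2 ≤ _ at h1
  linarith

/-- Sub-Gaussian bound for the exponential moments of a centered random variable whose square is
dominated by a variable with an exponential moment. -/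
theorem lintegral_exp_centered_le (hZ : Measurable Z) (ha : Measurable a) (ha0 : ∀ y, 0 ≤ a y)
    (hr : 0 ≤ r) (hZa : ∀ y, Z y ^ 2 ≤ r ^ 2 * a y)
    (hae : ∫⁻ y, ENNReal.ofReal (Real.exp (a y)) ∂ρ ≤ ENNReal.ofReal (Real.exp 1)) (t : ℝ) :
    ∫⁻ y, ENNReal.ofReal (Real.exp (t * ((∫ y', Z y' ∂ρ) - Z y))) ∂ρ
      ≤ ENNReal.ofReal (Real.exp (3 * t ^ 2 * r ^ 2)) := by
  obtain ⟨hai, ha1, hei, he1⟩ := integral_le_one_of_exp ha ha0 hae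
  obtain ⟨hZi, hm⟩ := integral_sq_le_of_exp hZ ha ha0 hZa hae
  set m := ∫ y, Z y ∂ρ with hmdef
  have htr : 0 ≤ t ^ 2 * r ^ 2 := by positivity
  -- With p = 3t²r²/2 ≤ 1, (3/4)(t(m - Z))² ≤ p(1 + a) = 2p + p(a - 1). Convexity allows replacing
  -- exp(p(a - 1)) by 1 - p + p exp(a - 1), whose mean is at most 1; the linear term has mean zero,
  -- and exp(2p) is the claim.
  rcases le_total (3 / 2 * (t ^ 2 * r ^ 2)) 1 with hp | hp
  · set p := 3 / 2 * (t ^ 2 * r ^ 2) with hpdef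
    have hp0 : 0 ≤ p := by positivity
    have hxi : Integrable (fun y => t * (m - Z y)) ρ :=
      ((integrable_const m).sub hZi).const_mul t
    have hBi : Integrable (fun y => Real.exp (2 * p) * (1 - p + p * Real.exp (a y - 1))) ρ :=
      ((integrable_const _).add (hei.const_mul p)).const_mul _
    refine lintegral_ofReal_le_of_integral_le
      (h' := fun y => t * (m - Z y) + Real.exp (2 * p) * (1 - p + p * Real.exp (a y - 1)))
      (fun y => ?_) (fun y => (Real.exp_pos _).le) (hxi.add hBi) ?_
    · refine (exp_le_add_exp_sq _).trans ?_
      have h1 : (t * (m - Z y)) ^ 2 ≤ 2 * (t ^ 2 * r ^ 2) + 2 * (t ^ 2 * r ^ 2) * a y := by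
        have h2 := mul_le_mul_of_nonneg_left (hZa y) (sq_nonneg t)
        have h3 := mul_le_mul_of_nonneg_left hm (sq_nonneg t)
        have h4 := sq_nonneg (t * (m + Z y))
        nlinarith
      have h2 : Real.exp (3 / 4 * (t * (m - Z y)) ^ 2)
          ≤ Real.exp (2 * p) * Real.exp (p * (a y - 1)) := by
        rw [← Real.exp_add]
        refine Real.exp_le_exp.2 ?_
        rw [hpdef]
        linarith
      have h3 : Real.exp (p * (a y - 1)) ≤ 1 - p + p * Real.exp (a y - 1) := by
        have := convexOn_exp.2 (Set.mem_univ (a y - 1)) (Set.mem_univ 0) hp0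
          (sub_nonneg.2 hp) (by ring)
        simp only [smul_eq_mul, mul_zero, add_zero, Real.exp_zero, mul_one] at this
        linarith
      have h4 := mul_le_mul_of_nonneg_left h3 (Real.exp_pos (2 * p)).le
      linarith
    · rw [integral_add hxi hBi, integral_const_mul, integral_const_mul,
        integral_sub (integrable_const _) hZi,
        integral_add (integrable_const _) (hei.const_mul p), integral_const_mul, integral_const,
        integral_const, probReal_univ, one_smul, one_smul, ← hmdef, sub_self, mul_zero, zero_add]
      have h1 : 1 - p + p * ∫ y, Real.exp (a y - 1) ∂ρ ≤ 1 := by nlinarith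
      have h2 : 2 * p = 3 * t ^ 2 * r ^ 2 := by rw [hpdef]; ring
      rw [h2]
      exact mul_le_of_le_one_right (Real.exp_pos _).le h1
  -- For large t centering is not needed: t(m - Z) ≤ τ + τ√a ≤ τ + τ²/4 + a. Since τ² ≥ 2/3, τ +
  -- τ²/4 + 1 ≤ 3τ²; the margin is small, hence the numerical bounds on τ below.
  · set τ := |t| * r with hτ
    have hτ0 : 0 ≤ τ := by positivity
    have hτ2 : τ ^ 2 = t ^ 2 * r ^ 2 := by rw [hτ, mul_pow, sq_abs]
    rw [← hτ2] at hp
    refine lintegral_ofReal_le_of_integral_le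
      (h' := fun y => Real.exp (τ + τ ^ 2 / 4 + 1) * Real.exp (a y - 1))
      (fun y => ?_) (fun y => (Real.exp_pos _).le) (hei.const_mul _) ?_
    · rw [← Real.exp_add]
      refine Real.exp_le_exp.2 ?_
      have h1 : t * m ≤ τ := by
        refine (le_abs_self _).trans ?_
        rw [abs_mul]
        exact mul_le_mul_of_nonneg_left (abs_le_of_sq_le_sq hm hr) (abs_nonneg t)
      have h2 : -(t * Z y) ≤ τ ^ 2 / 4 + a y := by
        have h3 : |Z y| ≤ r * √(a y) := by
          refine abs_le_of_sq_le_sq ?_ (by positivity)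
          rw [mul_pow, Real.sq_sqrt (ha0 y)]
          exact hZa y
        have h4 : -(t * Z y) ≤ |t| * |Z y| := by
          rw [← abs_mul]; exact neg_le_abs _
        have h5 := mul_le_mul_of_nonneg_left h3 (abs_nonneg t)
        have h6 := sq_nonneg (τ / 2 - √(a y))
        have h7 := Real.sq_sqrt (ha0 y)
        nlinarith
      linarith
    · rw [integral_const_mul]
      refine (mul_le_of_le_one_right (Real.exp_pos _).le he1).trans (Real.exp_le_exp.2 ?_)
      have h1 : 4 / 5 ≤ τ := by nlinarith
      have h2 : 3 * t ^ 2 * r ^ 2 = 3 * τ ^ 2 := by rw [hτ2]; ring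
      rw [h2]
      have h3 : 81 / 100 ≤ τ := by nlinarith
      nlinarith

end Exponential

/-! ### Recursions driven by independent samples, and Chernoff bounds. -/

section Recursion

variable {Ω Y S : Type*} [mΩ : MeasurableSpace Ω] [mY : MeasurableSpace Y] [MeasurableSpace S]
  {P : Measure Ω} [IsProbabilityMeasure P] {N : ℕ} {ζ : ℕ → Ω → Y}

omit [IsProbabilityMeasure P] in
/-- The current state of a recursion driven by independent samples is independent of the next
sample. -/
theorem indepFun_of_recursion (hm : ∀ k ∈ Finset.Icc 1 N, Measurable (ζ k))
    (hi : iIndepFun (fun (k : Finset.Icc 1 N) ω => ζ k ω) P) {x : ℕ → Ω → S}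
    {Φ : ℕ → S × Y → S} (hΦ : ∀ k < N, Measurable (Φ k)) {x₀ : S} (h0 : ∀ ω, x 0 ω = x₀)
    (hx : ∀ k < N, ∀ ω, x (k + 1) ω = Φ k (x k ω, ζ (k + 1) ω)) :
    ∀ k < N, Measurable (x k) ∧ IndepFun (x k) (ζ (k + 1)) P := by
  let m : Finset.Icc 1 N → MeasurableSpace Ω := fun l => mY.comap (ζ l)
  have hle : ∀ l, m l ≤ mΩ := fun l => (hm l l.2).comap_le
  -- The state is adapted: it depends only on samples 1, …, k, whose σ-algebra is independent of
  -- that of sample k + 1.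
  have key : ∀ k ≤ N, Measurable[⨆ l ∈ {l : Finset.Icc 1 N | (l : ℕ) ≤ k}, m l] (x k) := by
    intro k
    induction k with
    | zero =>
      intro _
      have : x 0 = fun _ => x₀ := funext h0
      rw [this]
      exact measurable_const
    | succ k ih =>
      intro hk
      have h1 := ih (by omega)
      have e : x (k + 1) = fun ω => Φ k (x k ω, ζ (k + 1) ω) := funext (hx k hk)
      rw [e]
      have hmem : k + 1 ∈ Finset.Icc 1 N := Finset.mem_Icc.2 ⟨by omega, hk⟩
      refine (hΦ k hk).comp (Measurable.prodMk ?_ ?_)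
      · refine h1.mono (biSup_mono fun l hl => ?_) le_rfl
        rw [Set.mem_ofPred_eq] at hl ⊢
        omega
      · exact (comap_measurable (ζ (k + 1))).mono
          (le_biSup m (i := ⟨k + 1, hmem⟩) (by rw [Set.mem_ofPred_eq])) le_rfl
  intro k hk
  have h1 := key k hk.le
  have hmem : k + 1 ∈ Finset.Icc 1 N := Finset.mem_Icc.2 ⟨by omega, hk⟩
  refine ⟨h1.mono (iSup₂_le fun l _ => hle l) le_rfl, ?_⟩
  have hd : Disjoint {l : Finset.Icc 1 N | (l : ℕ) ≤ k} {⟨k + 1, hmem⟩} := by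
    rw [Set.disjoint_singleton_right, Set.mem_ofPred_eq]
    simp
  have h2 := indep_iSup_of_disjoint hle hi hd
  rw [IndepFun_iff_Indep]
  refine indep_of_indep_of_le_left (indep_of_indep_of_le_right h2 ?_) h1.comap_le
  exact le_biSup m (i := ⟨k + 1, hmem⟩) (Set.mem_singleton _)

/-- This plays the role of conditioning on `x`: the joint law is a product, so by Tonelli's theorem
the state can be frozen while the sample is integrated. -/
theorem lintegral_comp_le_of_indepFun {ρ : Measure Y} [IsProbabilityMeasure ρ] {x : Ω → S}
    {y : Ω → Y} (hx : Measurable x) (hy : Measurable y) (hi : IndepFun x y P)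
    (hl : P.map y = ρ) {F : S → Y → ENNReal} (hF : Measurable fun p : S × Y => F p.1 p.2)
    {H : S → ENNReal} (hH : ∀ s, ∫⁻ z, F s z ∂ρ ≤ H s) :
    ∫⁻ ω, F (x ω) (y ω) ∂P ≤ ∫⁻ ω, H (x ω) ∂P := by
  have h1 := (indepFun_iff_map_prod_eq_prod_map_map hx.aemeasurable hy.aemeasurable).1 hi
  calc ∫⁻ ω, F (x ω) (y ω) ∂P = ∫⁻ p, F p.1 p.2 ∂(P.map fun ω => (x ω, y ω)) :=
        (lintegral_map hF (hx.prodMk hy)).symm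
    _ = ∫⁻ s, ∫⁻ z, F s z ∂ρ ∂(P.map x) := by
        rw [h1, hl, lintegral_prod _ hF.aemeasurable]
    _ = ∫⁻ ω, ∫⁻ z, F (x ω) z ∂ρ ∂P := lintegral_map hF.lintegral_prod_right' hx
    _ ≤ _ := lintegral_mono fun ω => hH _

/-- Exponential moments of a sum of increments, each of which is conditionally sub-Gaussian. -/
theorem lintegral_exp_sum_le {ρ : Measure Y} [IsProbabilityMeasure ρ]
    (hm : ∀ k ∈ Finset.Icc 1 N, Measurable (ζ k))
    (hi : iIndepFun (fun (k : Finset.Icc 1 N) ω => ζ k ω) P)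
    (hl : ∀ k ∈ Finset.Icc 1 N, P.map (ζ k) = ρ) {x : ℕ → Ω → S}
    {Φ : ℕ → S × Y → S} (hΦ : ∀ k < N, Measurable (Φ k)) {x₀ : S} (h0 : ∀ ω, x 0 ω = x₀)
    (hx : ∀ k < N, ∀ ω, x (k + 1) ω = Φ k (x k ω, ζ (k + 1) ω))
    {d : S × Y → ℝ} (hd : Measurable d) (θ c : ℕ → ℝ)
    (hc : ∀ k < N, ∀ s, ∫⁻ z, ENNReal.ofReal (Real.exp (θ k * d (s, z))) ∂ρ
      ≤ ENNReal.ofReal (Real.exp (c k))) :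
    ∀ n ≤ N, ∫⁻ ω, ENNReal.ofReal
        (Real.exp (∑ k ∈ Finset.range n, θ k * d (x k ω, ζ (k + 1) ω))) ∂P
      ≤ ENNReal.ofReal (Real.exp (∑ k ∈ Finset.range n, c k)) := by
  intro n
  induction n with
  | zero => simp
  | succ n ih =>
    intro hn
    have hmem : n + 1 ∈ Finset.Icc 1 N := Finset.mem_Icc.2 ⟨by omega, hn⟩
    -- The partial sum is added to the state, so that state and past increments are jointly
    -- independent of the next sample.
    obtain ⟨hxm, hxi⟩ := indepFun_of_recursion (S := S × ℝ) hm hi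
      (x := fun k ω => (x k ω, ∑ l ∈ Finset.range k, θ l * d (x l ω, ζ (l + 1) ω)))
      (Φ := fun k p => (Φ k (p.1.1, p.2), p.1.2 + θ k * d (p.1.1, p.2))) (x₀ := (x₀, 0))
      (fun k hk => by
        have h1 : Measurable fun p : (S × ℝ) × Y => (p.1.1, p.2) := by fun_prop
        exact ((hΦ k hk).comp h1).prodMk
          (measurable_fst.snd.add ((hd.comp h1).const_mul (θ k))))
      (fun ω => by simp [h0 ω])
      (fun k hk ω => by simp only [hx k hk ω, Finset.sum_range_succ]) n hn
    have h1 := lintegral_comp_le_of_indepFun hxm (hm _ hmem) hxi (hl _ hmem)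
      (F := fun s z => ENNReal.ofReal (Real.exp (s.2 + θ n * d (s.1, z))))
      (H := fun s => ENNReal.ofReal (Real.exp s.2) * ENNReal.ofReal (Real.exp (c n)))
      (by fun_prop) (fun s => by
        simp_rw [Real.exp_add, ENNReal.ofReal_mul (Real.exp_pos s.2).le]
        rw [lintegral_const_mul _ (by fun_prop)]
        gcongr
        exact hc n hn s.1)
    simp only [Finset.sum_range_succ]
    refine h1.trans ?_
    rw [lintegral_mul_const' _ _ ENNReal.ofReal_ne_top, Real.exp_add,
      ENNReal.ofReal_mul (Real.exp_pos _).le]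
    gcongr
    exact ih (by omega)

omit [IsProbabilityMeasure P] in
/-- Chernoff's bound. -/
theorem measureReal_le_exp_of_lintegral_exp {B : Ω → ℝ} (hB : Measurable B) {u v : ℝ} {s : Set Ω}
    (hs : ∀ ω ∈ s, u ≤ B ω)
    (hle : ∫⁻ ω, ENNReal.ofReal (Real.exp (B ω)) ∂P ≤ ENNReal.ofReal (Real.exp v)) :
    P.real s ≤ Real.exp (v - u) := by
  refine ENNReal.toReal_le_of_le_ofReal (Real.exp_pos _).le ?_
  have hsub : s ⊆ {ω | ENNReal.ofReal (Real.exp u) ≤ ENNReal.ofReal (Real.exp (B ω))} :=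
    fun ω h => ENNReal.ofReal_le_ofReal (Real.exp_le_exp.2 (hs ω h))
  have h1 : ENNReal.ofReal (Real.exp u) * P s ≤ ENNReal.ofReal (Real.exp v) :=
    (mul_le_mul_right (measure_mono hsub) _).trans
      ((mul_meas_ge_le_lintegral (by fun_prop) _).trans hle)
  rw [Real.exp_sub, ENNReal.ofReal_div_of_pos (Real.exp_pos u),
    ENNReal.le_div_iff_mul_le (Or.inl (by simp [Real.exp_pos])) (Or.inl ENNReal.ofReal_ne_top),
    mul_comm]
  exact h1

omit [IsProbabilityMeasure P] in
-- With weights c k / W summing to 1, Jensen's inequality gives the weighted mean an exponential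
-- moment at most e under any dependence; Chernoff's bound at level 1 + l follows.
theorem measureReal_weighted_sum_ge_le {a : ℕ → Ω → ℝ} (ha : ∀ k < N, Measurable (a k))
    (hae : ∀ k < N, ∫⁻ ω, ENNReal.ofReal (Real.exp (a k ω)) ∂P ≤ ENNReal.ofReal (Real.exp 1))
    {c : ℕ → ℝ} (hc : ∀ k < N, 0 ≤ c k) (hW : 0 < ∑ k ∈ Finset.range N, c k) (l : ℝ) :
    P.real {ω | (1 + l) * ∑ k ∈ Finset.range N, c k ≤ ∑ k ∈ Finset.range N, c k * a k ω}
      ≤ Real.exp (-l) := by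
  set W := ∑ k ∈ Finset.range N, c k with hWdef
  have hB : Measurable fun ω => ∑ k ∈ Finset.range N, c k / W * a k ω :=
    Finset.measurable_fun_sum _ fun k hk => (ha k (Finset.mem_range.1 hk)).const_mul _
  have hw1 : ∑ k ∈ Finset.range N, c k / W = 1 := by
    rw [← Finset.sum_div, div_self hW.ne']
  have hw0 : ∀ k ∈ Finset.range N, 0 ≤ c k / W := fun k hk =>
    div_nonneg (hc k (Finset.mem_range.1 hk)) hW.le
  have h := measureReal_le_exp_of_lintegral_exp (P := P) hB (u := 1 + l) (v := 1)
    (s := {ω | (1 + l) * W ≤ ∑ k ∈ Finset.range N, c k * a k ω}) (fun ω hω => by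
      rw [Set.mem_ofPred_eq] at hω
      have e : ∑ k ∈ Finset.range N, c k / W * a k ω
          = (∑ k ∈ Finset.range N, c k * a k ω) / W := by
        rw [Finset.sum_div]; exact Finset.sum_congr rfl fun k _ => by ring
      rw [e, le_div_iff₀ hW]
      exact hω) ?_
  · simpa using h
  calc ∫⁻ ω, ENNReal.ofReal (Real.exp (∑ k ∈ Finset.range N, c k / W * a k ω)) ∂P
      ≤ ∫⁻ ω, ∑ k ∈ Finset.range N, ENNReal.ofReal (c k / W) *
          ENNReal.ofReal (Real.exp (a k ω)) ∂P := by
        refine lintegral_mono fun ω => ?_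
        have h1 := convexOn_exp.map_sum_le hw0 hw1 (p := fun k => a k ω) fun _ _ => Set.mem_univ _
        simp only [smul_eq_mul] at h1
        refine (ENNReal.ofReal_le_ofReal h1).trans ?_
        rw [ENNReal.ofReal_sum_of_nonneg fun k hk => mul_nonneg (hw0 k hk) (Real.exp_pos _).le]
        exact Finset.sum_le_sum fun k hk => by rw [ENNReal.ofReal_mul (hw0 k hk)]
    _ = ∑ k ∈ Finset.range N, ENNReal.ofReal (c k / W) *
          ∫⁻ ω, ENNReal.ofReal (Real.exp (a k ω)) ∂P := by
        rw [lintegral_finsetSum']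
        · exact Finset.sum_congr rfl fun k _ => lintegral_const_mul' _ _ ENNReal.ofReal_ne_top
        · intro k hk
          have := ha k (Finset.mem_range.1 hk)
          fun_prop
    _ ≤ ∑ k ∈ Finset.range N, ENNReal.ofReal (c k / W) * ENNReal.ofReal (Real.exp 1) :=
        Finset.sum_le_sum fun k hk => by
          gcongr
          exact hae k (Finset.mem_range.1 hk)
    _ = ENNReal.ofReal (Real.exp 1) := by
        rw [← Finset.sum_mul, ← ENNReal.ofReal_sum_of_nonneg hw0, hw1, ENNReal.ofReal_one, one_mul]

omit [IsProbabilityMeasure P] in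
theorem measureReal_subGaussian_gt_le {B : Ω → ℝ} (hB : Measurable B) {v : ℝ} (hv : 0 < v)
    (hle : ∀ t : ℝ, ∫⁻ ω, ENNReal.ofReal (Real.exp (t * B ω)) ∂P
      ≤ ENNReal.ofReal (Real.exp (3 * t ^ 2 * v))) {l : ℝ} (hl : 0 < l) :
    P.real {ω | l * (2 * √v) < B ω} ≤ Real.exp (-l ^ 2 / 3) := by
  have hs := Real.sqrt_pos.2 hv
  have hs2 := Real.sq_sqrt hv.le
  -- Minimizer of the Chernoff exponent 3t²v - 2tl√v, with value -l²/3.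
  set t := l / (3 * √v) with ht
  have h := measureReal_le_exp_of_lintegral_exp (P := P) (hB.const_mul t) (u := 2 * l ^ 2 / 3)
    (s := {ω | l * (2 * √v) < B ω}) (fun ω hω => by
      rw [Set.mem_ofPred_eq] at hω
      have h1 : t * (l * (2 * √v)) ≤ t * B ω := mul_le_mul_of_nonneg_left hω.le (by positivity)
      refine le_trans (le_of_eq ?_) h1
      rw [ht]; field_simp) (hle t)
  refine h.trans (le_of_eq ?_)
  congr 1
  rw [ht, div_pow, mul_pow, hs2]
  field_simp
  ring

end Recursion

/-! ### The output as a weighted mean, and the telescoped inequality. -/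

section Deterministic

variable {b : ℕ} {E : Fin b → Type*} [∀ i, NormedAddCommGroup (E i)] [∀ i, NormedSpace ℝ (E i)]
  {Ξ : Type*} {X : ∀ i, Set (E i)} {w : ∀ i, E i → ℝ} {dw : ∀ i, E i → StrongDual ℝ (E i)}
  {G : (∀ i, E i) → Ξ → ∀ i, StrongDual ℝ (E i)} {γ θ : ℕ → ℝ}

theorem sum_Icc_one_eq_sum_range (h : ℕ → ℝ) (n : ℕ) :
    ∑ k ∈ Finset.Icc 1 n, h k = ∑ k ∈ Finset.range n, h (k + 1) := by
  induction n with
  | zero => simp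
  | succ n ih => rw [Finset.sum_Icc_succ_top (by omega), ih, Finset.sum_range_succ]

/-- The update rule for `s` and `u` adds the weighted current search point to the implicit sum. -/
theorem step_sum (k : ℕ) (j : Fin b) (z : Ξ) (st : State E) (i : Fin b) (hu : st.u i ≤ k + 1) :
    (step X w dw G γ θ (k + 1) j z st).s i
      + (∑ l ∈ Finset.Icc ((step X w dw G γ θ (k + 1) j z st).u i) (k + 1), θ l) • st.x i
      = st.s i + (∑ l ∈ Finset.Icc (st.u i) k, θ l) • st.x i + θ (k + 1) • st.x i := by
  have e : ∑ l ∈ Finset.Icc (st.u i) (k + 1), θ l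
      = ∑ l ∈ Finset.Icc (st.u i) k, θ l + θ (k + 1) := Finset.sum_Icc_succ_top hu _
  by_cases h : i = j
  · subst h
    simp [step, e, add_smul, add_assoc]
  · simp [step, h, e, add_smul, add_assoc]

theorem run_sum (x₁ : ∀ i, E i) (blk : ℕ → Fin b) (ξ : ℕ → Ξ) (n : ℕ) (i : Fin b) :
    (run X w dw G γ θ x₁ blk ξ n).u i ≤ n + 1 ∧
    (run X w dw G γ θ x₁ blk ξ n).s i
      + (∑ l ∈ Finset.Icc ((run X w dw G γ θ x₁ blk ξ n).u i) n, θ l) •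
        (run X w dw G γ θ x₁ blk ξ n).x i
      = ∑ k ∈ Finset.range n, θ (k + 1) • (run X w dw G γ θ x₁ blk ξ k).x i := by
  induction n with
  | zero => simp [run]
  | succ n ih =>
    obtain ⟨hu, hs⟩ := ih
    have h1 := step_sum (X := X) (w := w) (dw := dw) (G := G) (γ := γ) (θ := θ) n (blk (n + 1))
      (ξ (n + 1)) (run X w dw G γ θ x₁ blk ξ n) i hu
    rw [Finset.sum_range_succ, ← hs, ← h1]
    -- In the updated block the remaining weight is an empty sum, so the new search point does not
    -- enter; in the others it is unchanged.
    by_cases h : i = blk (n + 1)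
    · simp [run, step, h]
    · refine ⟨?_, ?_⟩
      · simp only [run, step, Function.update_of_ne h]; omega
      · simp [run, step, h]

theorem output_eq_centerMass (x₁ : ∀ i, E i) (blk : ℕ → Fin b) (ξ : ℕ → Ξ) {N : ℕ} (hN : 1 ≤ N) :
    output X w dw G γ θ x₁ N blk ξ = (Finset.range N).centerMass (fun k => θ (k + 1))
      fun k => (run X w dw G γ θ x₁ blk ξ k).x := by
  obtain ⟨n, rfl⟩ : ∃ n, N = n + 1 := ⟨N - 1, by omega⟩
  ext i
  obtain ⟨hu, hs⟩ := run_sum (X := X) (w := w) (dw := dw) (G := G) (γ := γ) (θ := θ) x₁ blk ξ n i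
  have h1 := step_sum (X := X) (w := w) (dw := dw) (G := G) (γ := γ) (θ := θ) n (blk (n + 1))
      (ξ (n + 1)) (run X w dw G γ θ x₁ blk ξ n) i hu
  rw [hs] at h1
  unfold output Finset.centerMass
  rw [Pi.smul_apply, Finset.sum_apply, sum_Icc_one_eq_sum_range, add_tsub_cancel_right]
  refine congrArg _ (Eq.trans h1 ?_)
  rw [Finset.sum_range_succ]
  rfl

/-- One iteration decreases the total prox-function, up to the error terms. -/
theorem sum_prox_step_le (hXc : ∀ i, Convex ℝ (X i)) (hX : ∀ i, IsCompact (X i))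
    (hw : ∀ i, IsDistanceGenerating (X i) (w i) (dw i)) {st : State E}
    (hst : st.x ∈ Set.univ.pi X) {y : ∀ i, E i} (hy : y ∈ Set.univ.pi X) (k : ℕ) (hk : 0 < γ k)
    (j : Fin b) (z : Ξ) :
    ∑ i, prox (w i) (dw i) ((step X w dw G γ θ k j z st).x i) (y i)
      ≤ ∑ i, prox (w i) (dw i) (st.x i) (y i) - γ k * G st.x z j (st.x j - y j)
        + 1 / 2 * γ k ^ 2 * ‖G st.x z j‖ ^ 2 := by
  have h := (hw j).prox_proxMap_le (hXc j) (hX j) (hst j trivial) (hy j trivial) (G st.x z j) hk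
  rw [← Finset.add_sum_erase _ _ (Finset.mem_univ j),
    ← Finset.add_sum_erase (a := j) _ (fun i => prox (w i) (dw i) (st.x i) (y i))
      (Finset.mem_univ j)]
  have e : ∑ i ∈ Finset.univ.erase j, prox (w i) (dw i) ((step X w dw G γ θ k j z st).x i) (y i)
      = ∑ i ∈ Finset.univ.erase j, prox (w i) (dw i) (st.x i) (y i) :=
    Finset.sum_congr rfl fun i hi => by
      simp only [step, Function.update_of_ne (Finset.ne_of_mem_erase hi)]
  rw [e]
  simp only [step, Function.update_self]
  linarith

/-- Telescoping of the one-step inequalities, weighted by `1 / Γ`. -/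
theorem weighted_telescope {N : ℕ} {β κ : ℝ} (hβ : 0 < β) {Γ : ℕ → ℝ} {F V z q m : ℕ → ℝ}
    (hγ : ∀ k ∈ Finset.Icc 1 N, 0 < γ k) (hΓ : ∀ k ∈ Finset.Icc 1 N, 0 < Γ k) (hΓ1 : Γ 1 = 1)
    (hΓs : ∀ k, k + 2 ≤ N → Γ (k + 2) = Γ (k + 1) * (1 - γ (k + 2) * κ / β))
    (hθ : ∀ k ∈ Finset.Icc 1 N, θ k = γ k / Γ k)
    (hV : ∀ k < N, V (k + 1) ≤ V k - γ (k + 1) * z k + 1 / 2 * γ (k + 1) ^ 2 * q k)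
    (hF : ∀ k < N, F k + κ * V k ≤ β * m k) (n : ℕ) (hn : n < N) :
    (∑ k ∈ Finset.range (n + 1), θ (k + 1) * F k) / β + V (n + 1) / Γ (n + 1)
      ≤ (1 - γ 1 * κ / β) * V 0
        + 1 / 2 * ∑ k ∈ Finset.range (n + 1), γ (k + 1) * θ (k + 1) * q k
        + ∑ k ∈ Finset.range (n + 1), θ (k + 1) * (m k - z k) := by
  have hstep : ∀ k < N, θ (k + 1) * F k / β + V (k + 1) / Γ (k + 1)
      ≤ (1 - γ (k + 1) * κ / β) * V k / Γ (k + 1)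
        + 1 / 2 * (γ (k + 1) * θ (k + 1) * q k) + θ (k + 1) * (m k - z k) := by
    intro k hk
    have hmem : k + 1 ∈ Finset.Icc 1 N := Finset.mem_Icc.2 ⟨by omega, hk⟩
    have h1 := hΓ _ hmem
    have h2 := hγ _ hmem
    have h3 := mul_le_mul_of_nonneg_left (hV k hk) (inv_pos.2 h1).le
    have h4 := mul_le_mul_of_nonneg_left (hF k hk)
      (by positivity : 0 ≤ γ (k + 1) / Γ (k + 1) / β)
    have e4 : γ (k + 1) / Γ (k + 1) / β * (β * m k) = γ (k + 1) / Γ (k + 1) * m k := by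
      field_simp
    rw [e4] at h4
    rw [hθ _ hmem]
    simp only [div_eq_mul_inv] at h3 h4 ⊢
    linarith
  induction n with
  | zero =>
    have := hstep 0 hn
    simpa [hΓ1] using this
  | succ n ih =>
    have h1 := ih (by omega)
    have h2 := hstep (n + 1) hn
    have hmem : n + 1 + 1 ∈ Finset.Icc 1 N := Finset.mem_Icc.2 ⟨by omega, hn⟩
    have hmem' : n + 1 ∈ Finset.Icc 1 N := Finset.mem_Icc.2 ⟨by omega, by omega⟩
    -- The recursion for Γ cancels the contraction factor. Since Γ 1 = 1, the factor of the first
    -- step remains in the bound.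
    have e : (1 - γ (n + 1 + 1) * κ / β) * V (n + 1) / Γ (n + 1 + 1) = V (n + 1) / Γ (n + 1) := by
      have h3 := hΓs n hn
      have h4 := hΓ _ hmem
      have h5 := hΓ _ hmem'
      rw [div_eq_div_iff h4.ne' h5.ne', show n + 1 + 1 = n + 2 from rfl, h3]
      ring
    rw [e] at h2
    rw [Finset.sum_range_succ, Finset.sum_range_succ (fun k => γ (k + 1) * θ (k + 1) * q k) (n + 1),
      Finset.sum_range_succ (fun k => θ (k + 1) * (m k - z k)) (n + 1), add_div]
    linarith

end Deterministic

/-! ### The measurable recursion on the feasible set, and its noise. -/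

section Stochastic

variable {b : ℕ} {E : Fin b → Type*} [∀ i, NormedAddCommGroup (E i)] [∀ i, NormedSpace ℝ (E i)]
  {Ξ : Type*} {X : ∀ i, Set (E i)} {w : ∀ i, E i → ℝ} {dw : ∀ i, E i → StrongDual ℝ (E i)}
  {G : (∀ i, E i) → Ξ → ∀ i, StrongDual ℝ (E i)} {γ θ : ℕ → ℝ}

/-- The recursion for the search points, on the feasible set. -/
noncomputable def feasibleStep (hX : ∀ i, IsCompact (X i)) (hw : ∀ i, IsDistanceGenerating (X i) (w i) (dw i))
    (G : (∀ i, E i) → Ξ → ∀ i, StrongDual ℝ (E i)) (c : ℝ)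
    (p : Set.univ.pi X × (Fin b × Ξ)) : Set.univ.pi X :=
  ⟨fun i => if p.2.1 = i then
      tiltedArgmin (X i) (w i) (c • G p.1.1 p.2.2 i - dw i (p.1.1 i)) else p.1.1 i, fun i _ => by
    dsimp only
    split_ifs
    · exact ((hw i).tiltedArgmin_spec (hX i) ⟨_, p.1.2 i trivial⟩ _).1
    · exact p.1.2 i trivial⟩

theorem step_x_eq_feasibleStep (hX : ∀ i, IsCompact (X i))
    (hw : ∀ i, IsDistanceGenerating (X i) (w i) (dw i)) (k : ℕ) (hk : 0 < γ k) (j : Fin b) (z : Ξ)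
    (st : State E) (hst : st.x ∈ Set.univ.pi X) :
    (step X w dw G γ θ k j z st).x = feasibleStep hX hw G (γ k) (⟨st.x, hst⟩, (j, z)) := by
  ext i
  by_cases h : j = i
  · subst h
    simp [step, feasibleStep, proxMap_eq_tiltedArgmin _ _ _ _ _ hk]
  · simp [step, feasibleStep, h, Function.update_of_ne (Ne.symm h)]

/-- The search points of the algorithm, as a recursion on the feasible set. -/
noncomputable def feasibleRun (hX : ∀ i, IsCompact (X i))
    (hw : ∀ i, IsDistanceGenerating (X i) (w i) (dw i))
    (G : (∀ i, E i) → Ξ → ∀ i, StrongDual ℝ (E i)) (γ : ℕ → ℝ) (x₁ : Set.univ.pi X)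
    (ζ : ℕ → Fin b × Ξ) : ℕ → Set.univ.pi X
  | 0 => x₁
  | k + 1 => feasibleStep hX hw G (γ (k + 1)) (feasibleRun hX hw G γ x₁ ζ k, ζ (k + 1))

theorem run_x_eq_feasibleRun (hX : ∀ i, IsCompact (X i))
    (hw : ∀ i, IsDistanceGenerating (X i) (w i) (dw i)) (x₁ : Set.univ.pi X) (blk : ℕ → Fin b)
    (ξ : ℕ → Ξ) {N : ℕ} (hγ : ∀ k ∈ Finset.Icc 1 N, 0 < γ k) {n : ℕ} (hn : n ≤ N) :
    (run X w dw G γ θ x₁ blk ξ n).x = feasibleRun hX hw G γ x₁ (fun k => (blk k, ξ k)) n := by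
  induction n with
  | zero => rfl
  | succ n ih =>
    have h := ih (by omega)
    have hmem : (run X w dw G γ θ x₁ blk ξ n).x ∈ Set.univ.pi X := by rw [h]; exact Subtype.property _
    have h1 := step_x_eq_feasibleStep (G := G) (θ := θ) hX hw (n + 1)
      (hγ _ (Finset.mem_Icc.2 ⟨by omega, hn⟩)) (blk (n + 1)) (ξ (n + 1)) _ hmem
    refine h1.trans ?_
    simp only [h]
    rfl

variable [MeasurableSpace Ξ]

/-- The law of `(i_k, ξ_k)`. -/
noncomputable def sampleLaw (b : ℕ) (ν : Measure Ξ) : Measure (Fin b × Ξ) :=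
  ((b : ENNReal)⁻¹ • Measure.count).prod ν

instance [NeZero b] : IsProbabilityMeasure ((b : ENNReal)⁻¹ • Measure.count : Measure (Fin b)) :=
  ⟨by
    rw [Measure.smul_apply, Measure.count_apply MeasurableSet.univ]
    simp [ENNReal.inv_mul_cancel, NeZero.ne b]⟩

instance [NeZero b] (ν : Measure Ξ) [IsProbabilityMeasure ν] :
    IsProbabilityMeasure (sampleLaw b ν) := by
  unfold sampleLaw; infer_instance

theorem lintegral_sampleLaw (ν : Measure Ξ) [SFinite ν] {F : Fin b × Ξ → ENNReal}
    (hF : Measurable F) :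
    ∫⁻ p, F p ∂(sampleLaw b ν) = (b : ENNReal)⁻¹ * ∑ i, ∫⁻ z, F (i, z) ∂ν := by
  unfold sampleLaw
  rw [lintegral_prod _ hF.aemeasurable, lintegral_smul_measure, lintegral_count, tsum_fintype,
    smul_eq_mul]

theorem integral_sampleLaw (ν : Measure Ξ) [SFinite ν] {F : Fin b × Ξ → ℝ}
    (hF : Integrable F (sampleLaw b ν)) :
    ∫ p, F p ∂(sampleLaw b ν) = (b : ℝ)⁻¹ * ∑ i, ∫ z, F (i, z) ∂ν := by
  unfold sampleLaw at hF ⊢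
  rw [integral_prod _ hF, integral_smul_measure, integral_count, smul_eq_mul, ENNReal.toReal_inv,
    ENNReal.toReal_natCast]

theorem IsUniformSampling.map_pair {Ω : Type*} [MeasurableSpace Ω] {P : Measure Ω}
    [IsProbabilityMeasure P] {ν : Measure Ξ} {N : ℕ} {blk : ℕ → Ω → Fin b} {ξ : ℕ → Ω → Ξ}
    (h : IsUniformSampling P ν N blk ξ) {k : ℕ} (hk : k ∈ Finset.Icc 1 N) :
    P.map (fun ω => (blk k ω, ξ k ω)) = sampleLaw b ν := by
  have h1 := h.measurable_blk k hk
  rw [(indepFun_iff_map_prod_eq_prod_map_map h1.aemeasurable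
    (h.measurable_sample k hk).aemeasurable).1 (h.indep_pair k hk), h.law k hk]
  unfold sampleLaw
  congr 1
  refine Measure.ext_of_singleton fun j => ?_
  rw [Measure.map_apply h1 (measurableSet_singleton j), Measure.smul_apply,
    Measure.count_singleton, smul_eq_mul, mul_one]
  have h2 := h.uniform k hk j
  have hb : (b : ℝ) ≠ 0 := by
    have : NeZero b := ⟨fun hb => by subst hb; exact j.elim0⟩
    exact Nat.cast_ne_zero.2 (NeZero.ne b)
  have h3 : P (blk k ⁻¹' {j}) = ENNReal.ofReal (1 / b) := by
    rw [← h2, ofReal_measureReal]; rfl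
  rw [h3, one_div, ENNReal.ofReal_inv_of_pos (lt_of_le_of_ne (Nat.cast_nonneg b) hb.symm),
    ENNReal.ofReal_natCast]

variable [∀ i, FiniteDimensional ℝ (E i)] [∀ i, MeasurableSpace (E i)] [∀ i, BorelSpace (E i)]

theorem measurable_feasibleStep (hXc : ∀ i, Convex ℝ (X i)) (hX : ∀ i, IsCompact (X i))
    (hw : ∀ i, IsDistanceGenerating (X i) (w i) (dw i))
    (hG : ∀ i, Measurable fun p : (∀ i, E i) × Ξ => G p.1 p.2 i) (c : ℝ) :
    Measurable (feasibleStep hX hw G c) := by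
  refine Measurable.subtype_mk (measurable_pi_iff.2 fun i => ?_)
  have hx : Measurable fun p : Set.univ.pi X × (Fin b × Ξ) => p.1.1 i :=
    (measurable_pi_apply i).comp (measurable_subtype_coe.comp measurable_fst)
  refine Measurable.ite (measurable_snd.fst (measurableSet_singleton i)) ?_ hx
  rcases (X i).eq_empty_or_nonempty with he | hne
  · have : IsEmpty (Set.univ.pi X × (Fin b × Ξ)) :=
      ⟨fun p => by have := p.1.2 i trivial; rw [he] at this; exact this⟩
    exact measurable_of_empty _
  refine ((hw i).lipschitzWith_tiltedArgmin (hXc i) (hX i) hne).continuous.measurable.comp ?_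
  have hG' : Measurable fun p : Set.univ.pi X × (Fin b × Ξ) => G p.1.1 p.2.2 i :=
    (hG i).comp ((measurable_subtype_coe.comp measurable_fst).prodMk measurable_snd.snd)
  have hd : Measurable fun p : Set.univ.pi X × (Fin b × Ξ) => dw i (p.1.1 i) := by
    -- `dw` is only known to be continuous on X i, which is why the recursion lives on the subtype.
    have h1 := (continuousOn_iff_continuous_domRestrict.1 (hw i).continuousOn_deriv).measurable
    exact h1.comp (hx.subtype_mk (h := fun p => p.1.2 i trivial))
  exact (hG'.const_smul c).sub hd

/-- The directional noisy slope `⟨G_j(x, z), x_j - y_j⟩`. -/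
noncomputable def slope (G : (∀ i, E i) → Ξ → ∀ i, StrongDual ℝ (E i)) (y : ∀ i, E i)
    (p : Set.univ.pi X × (Fin b × Ξ)) : ℝ :=
  G p.1.1 p.2.2 p.2.1 (p.1.1 p.2.1 - y p.2.1)

/-- The scaled squared norm of the sampled block of the stochastic subgradient. -/
noncomputable def noise (G : (∀ i, E i) → Ξ → ∀ i, StrongDual ℝ (E i)) (m : ℝ)
    (p : Set.univ.pi X × (Fin b × Ξ)) : ℝ :=
  ‖G p.1.1 p.2.2 p.2.1‖ ^ 2 / m ^ 2

omit [∀ i, NormedAddCommGroup (E i)] [∀ i, NormedSpace ℝ (E i)] [∀ i, FiniteDimensional ℝ (E i)]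
  [∀ i, BorelSpace (E i)] in
theorem measurable_of_forall_block {h : Set.univ.pi X × (Fin b × Ξ) → ℝ}
    (hh : ∀ i, Measurable fun p : (Set.univ.pi X) × Ξ => h (p.1, (i, p.2))) : Measurable h := by
  have h1 : Measurable fun q : (Set.univ.pi X × Ξ) × Fin b => h (q.1.1, (q.2, q.1.2)) :=
    measurable_from_prod_countable_left fun i => hh i
  exact h1.comp (g := fun q : (Set.univ.pi X × Ξ) × Fin b => h (q.1.1, (q.2, q.1.2)))
    (f := fun p : Set.univ.pi X × (Fin b × Ξ) => ((p.1, p.2.2), p.2.1)) (by fun_prop)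

theorem measurable_slope (hG : ∀ i, Measurable fun p : (∀ i, E i) × Ξ => G p.1 p.2 i)
    (y : ∀ i, E i) : Measurable (slope (X := X) G y) := by
  refine measurable_of_forall_block fun i => ?_
  have h1 : Measurable fun p : (Set.univ.pi X) × Ξ => G p.1.1 p.2 i :=
    (hG i).comp ((measurable_subtype_coe.comp measurable_fst).prodMk measurable_snd)
  have h2 : Measurable fun p : (Set.univ.pi X) × Ξ => p.1.1 i - y i :=
    ((measurable_pi_apply i).comp (measurable_subtype_coe.comp measurable_fst)).sub_const _
  have h3 : Continuous fun q : StrongDual ℝ (E i) × E i => q.1 q.2 := by fun_prop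
  exact h3.measurable.comp (h1.prodMk h2)

omit [∀ i, FiniteDimensional ℝ (E i)] [∀ i, BorelSpace (E i)] in
theorem measurable_noise (hG : ∀ i, Measurable fun p : (∀ i, E i) × Ξ => G p.1 p.2 i)
    (m : ℝ) : Measurable (noise (X := X) G m) := by
  refine measurable_of_forall_block fun i => ?_
  have h1 : Measurable fun p : (Set.univ.pi X) × Ξ => G p.1.1 p.2 i :=
    (hG i).comp ((measurable_subtype_coe.comp measurable_fst).prodMk measurable_snd)
  exact (h1.norm.pow_const 2).div_const _

variable [NeZero b] {ν : Measure Ξ} [IsProbabilityMeasure ν]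

omit [∀ i, FiniteDimensional ℝ (E i)] [∀ i, BorelSpace (E i)] in
theorem lintegral_exp_noise_le (hG : ∀ i, Measurable fun p : (∀ i, E i) × Ξ => G p.1 p.2 i)
    {M : Fin b → ℝ} (hM : ∀ i, 0 < M i) (htail : LightTail X G ν M) {m : ℝ} (hm : ∀ i, M i ≤ m)
    (x : Set.univ.pi X) :
    ∫⁻ p, ENNReal.ofReal (Real.exp (noise G m (x, p))) ∂(sampleLaw b ν)
      ≤ ENNReal.ofReal (Real.exp 1) := by
  have hn : Measurable fun p => noise G m (x, p) :=
    (measurable_noise hG m).comp measurable_prodMk_left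
  rw [lintegral_sampleLaw ν (by fun_prop)]
  have h1 : ∀ i, ∫⁻ z, ENNReal.ofReal (Real.exp (noise G m (x, (i, z)))) ∂ν
      ≤ ENNReal.ofReal (Real.exp 1) := fun i => by
    refine le_trans (lintegral_mono fun z => ?_) (htail x.1 x.2 i)
    refine ENNReal.ofReal_le_ofReal (Real.exp_le_exp.2 ?_)
    have := hM i
    have := hm i
    unfold noise
    dsimp only
    gcongr
  calc _ ≤ (b : ENNReal)⁻¹ * ∑ _i : Fin b, ENNReal.ofReal (Real.exp 1) := by
        gcongr with i; exact h1 i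
    _ = ENNReal.ofReal (Real.exp 1) := by
        rw [Finset.sum_const, Finset.card_univ, Fintype.card_fin, nsmul_eq_mul, ← mul_assoc,
          ENNReal.inv_mul_cancel (by simp [NeZero.ne b]) (ENNReal.natCast_ne_top b), one_mul]

omit [∀ i, FiniteDimensional ℝ (E i)] [∀ i, MeasurableSpace (E i)] [∀ i, BorelSpace (E i)]
  [MeasurableSpace Ξ] [NeZero b] in
-- The diameter bound in the sampled block, with that block's spread enlarged to the sum, which does
-- not depend on the sample.
theorem sq_slope_le (hXc : ∀ i, Convex ℝ (X i)) (hX : ∀ i, IsCompact (X i))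
    (hw : ∀ i, IsDistanceGenerating (X i) (w i) (dw i)) {m : ℝ} (hm : 0 < m) {y : ∀ i, E i}
    (hy : y ∈ Set.univ.pi X) (p : Set.univ.pi X × (Fin b × Ξ)) :
    slope G y p ^ 2 ≤ m ^ 2 * (8 * ∑ i, spread (X i) (w i)) * noise G m p := by
  have h0 : ∀ i, 0 ≤ spread (X i) (w i) := fun i =>
    (hw i).spread_nonneg (hXc i) (hX i) ⟨_, hy i trivial⟩
  have h1 := (hw p.2.1).sq_norm_sub_le_spread (hXc _) (hX _) (p.1.2 p.2.1 trivial)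
    (hy p.2.1 trivial)
  have h2 := Finset.single_le_sum (f := fun i => spread (X i) (w i)) (fun i _ => h0 i)
    (Finset.mem_univ p.2.1)
  have h3 : slope G y p ^ 2 ≤ (‖G p.1.1 p.2.2 p.2.1‖ * ‖p.1.1 p.2.1 - y p.2.1‖) ^ 2 := by
    rw [← sq_abs (slope G y p)]
    exact pow_le_pow_left₀ (abs_nonneg _) ((G p.1.1 p.2.2 p.2.1).le_opNorm _) 2
  have e : m ^ 2 * (8 * ∑ i, spread (X i) (w i)) * noise G m p
      = ‖G p.1.1 p.2.2 p.2.1‖ ^ 2 * (8 * ∑ i, spread (X i) (w i)) := by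
    unfold noise; field_simp
  rw [e]
  refine h3.trans ?_
  rw [mul_pow]
  gcongr
  linarith

omit [∀ i, FiniteDimensional ℝ (E i)] [∀ i, BorelSpace (E i)] [NeZero b] in
-- Averaging over the uniform block reassembles the full pairing, at the price of 1 / b.
theorem integral_slope {f : (∀ i, E i) → ℝ} {g : (∀ i, E i) → ∀ i, StrongDual ℝ (E i)}
    (hG : IsStochasticSubgradient X f g G ν) (y : ∀ i, E i) (x : Set.univ.pi X)
    (hi : Integrable (fun p => slope G y (x, p)) (sampleLaw b ν)) :
    ∫ p, slope G y (x, p) ∂(sampleLaw b ν) = (b : ℝ)⁻¹ * pairing (g x.1) (x.1 - y) := by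
  rw [integral_sampleLaw ν hi]
  unfold pairing slope
  congr 1
  refine Finset.sum_congr rfl fun i _ => ?_
  rw [← hG.unbiased x.1 x.2 i, ContinuousLinearMap.integral_apply (hG.integrable x.1 x.2 i)]
  rfl

end Stochastic

/-! ### Pathwise gap estimate and its tail bound. -/

section LargeDeviations

variable {b : ℕ} {E : Fin b → Type*} [∀ i, NormedAddCommGroup (E i)] [∀ i, NormedSpace ℝ (E i)]
  [∀ i, FiniteDimensional ℝ (E i)] [∀ i, MeasurableSpace (E i)] [∀ i, BorelSpace (E i)]
  {Ξ : Type*} [MeasurableSpace Ξ] {ν : Measure Ξ} [IsProbabilityMeasure ν]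
  {Ω : Type*} [MeasurableSpace Ω] {P : Measure Ω} [IsProbabilityMeasure P]
  {X : ∀ i, Set (E i)} {w : ∀ i, E i → ℝ} {dw : ∀ i, E i → StrongDual ℝ (E i)}
  {f : (∀ i, E i) → ℝ} {g : (∀ i, E i) → ∀ i, StrongDual ℝ (E i)}
  {G : (∀ i, E i) → Ξ → ∀ i, StrongDual ℝ (E i)} {γ θ : ℕ → ℝ}
  {N : ℕ} {blk : ℕ → Ω → Fin b} {ξ : ℕ → Ω → Ξ}

omit [∀ i, FiniteDimensional ℝ (E i)] [∀ i, MeasurableSpace (E i)] [∀ i, BorelSpace (E i)]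
  [MeasurableSpace Ξ] in
/-- Deterministic estimate for the output, in terms of the noise and of the martingale
differences. -/
theorem output_gap_le [NeZero b] (hXc : ∀ i, Convex ℝ (X i)) (hX : ∀ i, IsCompact (X i))
    (hw : ∀ i, IsDistanceGenerating (X i) (w i) (dw i)) (hf : ConvexOn ℝ (Set.univ.pi X) f)
    (x₁ : Set.univ.pi X) (hN : 1 ≤ N) (hγ : ∀ k ∈ Finset.Icc 1 N, 0 < γ k) {Γ : ℕ → ℝ} {κ C m : ℝ}
    (hm : 0 < m) (hΓ : ∀ k ∈ Finset.Icc 1 N, 0 < Γ k) (hΓ1 : Γ 1 = 1)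
    (hΓs : ∀ k, k + 2 ≤ N → Γ (k + 2) = Γ (k + 1) * (1 - γ (k + 2) * κ / b))
    (hθ : ∀ k ∈ Finset.Icc 1 N, θ k = γ k / Γ k) (hC : 1 - γ 1 * κ / b ≤ C)
    {y : ∀ i, E i} (hy : y ∈ Set.univ.pi X)
    (hsub : ∀ x ∈ Set.univ.pi X, f x - f y + κ * ∑ i, prox (w i) (dw i) (x i) (y i)
      ≤ pairing (g x) (x - y)) (bl : ℕ → Fin b) (ze : ℕ → Ξ) :
    f (output X w dw G γ θ x₁ N bl ze) - f y ≤ b * (∑ k ∈ Finset.Icc 1 N, θ k)⁻¹ *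
      (C * ∑ i, prox (w i) (dw i) (x₁.1 i) (y i)
        + 1 / 2 * (m ^ 2 * ∑ k ∈ Finset.range N, γ (k + 1) * θ (k + 1) *
          noise G m (feasibleRun hX hw G γ x₁ (fun k => (bl k, ze k)) k, (bl (k + 1), ze (k + 1))))
        + ∑ k ∈ Finset.range N, θ (k + 1) *
          ((b : ℝ)⁻¹ * pairing (g (feasibleRun hX hw G γ x₁ (fun k => (bl k, ze k)) k).1)
            ((feasibleRun hX hw G γ x₁ (fun k => (bl k, ze k)) k).1 - y)
          - slope G y (feasibleRun hX hw G γ x₁ (fun k => (bl k, ze k)) k,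
              (bl (k + 1), ze (k + 1))))) := by
  have hb : (0 : ℝ) < b := Nat.cast_pos.2 (NeZero.pos b)
  have hθ0 : ∀ k ∈ Finset.range N, 0 < θ (k + 1) := fun k hk => by
    have hmem : k + 1 ∈ Finset.Icc 1 N :=
      Finset.mem_Icc.2 ⟨by omega, Finset.mem_range.1 hk⟩
    rw [hθ _ hmem]
    exact div_pos (hγ _ hmem) (hΓ _ hmem)
  have hW : 0 < ∑ k ∈ Finset.range N, θ (k + 1) :=
    Finset.sum_pos hθ0 ⟨0, Finset.mem_range.2 hN⟩
  set xs := feasibleRun hX hw G γ x₁ (fun k => (bl k, ze k)) with hxs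
  have hrun : ∀ k ≤ N, (run X w dw G γ θ x₁ bl ze k).x = xs k := fun k hk =>
    run_x_eq_feasibleRun hX hw x₁ bl ze hγ hk
  have hV0 : ∀ k, 0 ≤ ∑ i, prox (w i) (dw i) ((xs k).1 i) (y i) := fun k =>
    Finset.sum_nonneg fun i _ => (hw i).prox_nonneg (hXc i) (hy i trivial) ((xs k).2 i trivial)
  obtain ⟨n, rfl⟩ : ∃ n, N = n + 1 := ⟨N - 1, by omega⟩
  have htel := weighted_telescope (N := n + 1) (β := b) (κ := κ) hb
    (F := fun k => f (xs k).1 - f y)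
    (V := fun k => ∑ i, prox (w i) (dw i) ((xs k).1 i) (y i))
    (z := fun k => slope G y (xs k, (bl (k + 1), ze (k + 1))))
    (q := fun k => m ^ 2 * noise G m (xs k, (bl (k + 1), ze (k + 1))))
    (m := fun k => (b : ℝ)⁻¹ * pairing (g (xs k).1) ((xs k).1 - y))
    hγ hΓ hΓ1 hΓs hθ (fun k hk => by
      have hmem : (run X w dw G γ θ x₁ bl ze k).x ∈ Set.univ.pi X := by
        rw [hrun k hk.le]; exact Subtype.property _
      have h := sum_prox_step_le (G := G) (θ := θ) hXc hX hw hmem hy (k + 1)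
        (hγ _ (Finset.mem_Icc.2 ⟨by omega, hk⟩)) (bl (k + 1)) (ze (k + 1))
      have e : (step X w dw G γ θ (k + 1) (bl (k + 1)) (ze (k + 1))
          (run X w dw G γ θ x₁ bl ze k)).x = xs (k + 1) := hrun (k + 1) hk
      rw [e, hrun k hk.le] at h
      have e2 : m ^ 2 * noise G m (xs k, (bl (k + 1), ze (k + 1)))
          = ‖G (xs k).1 (ze (k + 1)) (bl (k + 1))‖ ^ 2 := by
        unfold noise; field_simp
      rw [e2]
      exact h)
    (fun k _ => by
      rw [mul_inv_cancel_left₀ hb.ne']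
      exact hsub _ (xs k).2) n (Nat.lt_succ_self n)
  have hlast : 0 ≤ (∑ i, prox (w i) (dw i) ((xs (n + 1)).1 i) (y i)) / Γ (n + 1) :=
    div_nonneg (hV0 _) (hΓ _ (Finset.mem_Icc.2 ⟨by omega, le_rfl⟩)).le
  have hfirst := mul_le_mul_of_nonneg_right hC (hV0 0)
  have hconv : f (output X w dw G γ θ x₁ (n + 1) bl ze) - f y
      ≤ (∑ k ∈ Finset.range (n + 1), θ (k + 1))⁻¹ *
        ∑ k ∈ Finset.range (n + 1), θ (k + 1) * (f (xs k).1 - f y) := by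
    have h1 := hf.map_centerMass_le (t := Finset.range (n + 1)) (w := fun k => θ (k + 1))
      (p := fun k => (run X w dw G γ θ x₁ bl ze k).x) (fun k hk => (hθ0 k hk).le) hW
      (fun k hk => by
        rw [hrun k (Finset.mem_range.1 hk).le]; exact Subtype.property _)
    rw [output_eq_centerMass _ _ _ hN]
    have e : ∑ k ∈ Finset.range (n + 1), θ (k + 1) * (f (xs k).1 - f y)
        = ∑ k ∈ Finset.range (n + 1), θ (k + 1) * f (run X w dw G γ θ x₁ bl ze k).x
          - (∑ k ∈ Finset.range (n + 1), θ (k + 1)) * f y := by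
      rw [Finset.sum_mul, ← Finset.sum_sub_distrib]
      exact Finset.sum_congr rfl fun k hk => by rw [hrun k (Finset.mem_range.1 hk).le]; ring
    rw [e, mul_sub, inv_mul_cancel_left₀ hW.ne']
    exact sub_le_sub_right h1 _
  refine hconv.trans ?_
  rw [sum_Icc_one_eq_sum_range, mul_comm (b : ℝ), mul_assoc]
  refine mul_le_mul_of_nonneg_left ?_ (inv_pos.2 hW).le
  have h2 : (∑ k ∈ Finset.range (n + 1), θ (k + 1) * (f (xs k).1 - f y)) / b
      ≤ C * ∑ i, prox (w i) (dw i) (x₁.1 i) (y i)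
        + 1 / 2 * ∑ k ∈ Finset.range (n + 1), γ (k + 1) * θ (k + 1) *
          (m ^ 2 * noise G m (xs k, (bl (k + 1), ze (k + 1))))
        + ∑ k ∈ Finset.range (n + 1), θ (k + 1) * ((b : ℝ)⁻¹ *
          pairing (g (xs k).1) ((xs k).1 - y) - slope G y (xs k, (bl (k + 1), ze (k + 1)))) := by
    change _ ≤ C * ∑ i, prox (w i) (dw i) ((xs 0).1 i) (y i) + _ + _
    linarith
  rw [div_le_iff₀' hb] at h2
  refine h2.trans (le_of_eq ?_)
  rw [Finset.mul_sum (a := m ^ 2)]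
  congr 3
  congr 1
  exact Finset.sum_congr rfl fun k _ => by ring

/-- Large deviations for the output of the algorithm. -/
theorem measureReal_output_gap_ge_le (hXc : ∀ i, Convex ℝ (X i)) (hX : ∀ i, IsCompact (X i))
    (hw : ∀ i, IsDistanceGenerating (X i) (w i) (dw i)) (hf : ConvexOn ℝ (Set.univ.pi X) f)
    (hG : IsStochasticSubgradient X f g G ν) {M : Fin b → ℝ} (hM : ∀ i, 0 < M i)
    (htail : LightTail X G ν M) {x₁ : ∀ i, E i} (hx₁ : x₁ ∈ Set.univ.pi X) (hN : 1 ≤ N)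
    (hsample : IsUniformSampling P ν N blk ξ)
    (hγ : ∀ k ∈ Finset.Icc 1 N, 0 < γ k) {Γ : ℕ → ℝ} {κ C : ℝ}
    (hΓ : ∀ k ∈ Finset.Icc 1 N, 0 < Γ k) (hΓ1 : Γ 1 = 1)
    (hΓs : ∀ k, k + 2 ≤ N → Γ (k + 2) = Γ (k + 1) * (1 - γ (k + 2) * κ / b))
    (hθ : ∀ k ∈ Finset.Icc 1 N, θ k = γ k / Γ k) (hC : 1 - γ 1 * κ / b ≤ C)
    {y : ∀ i, E i} (hy : y ∈ Set.univ.pi X)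
    (hsub : ∀ x ∈ Set.univ.pi X, f x - f y + κ * ∑ i, prox (w i) (dw i) (x i) (y i)
      ≤ pairing (g x) (x - y)) {l : ℝ} (hl : 0 < l) :
    P.real {ω | f (output X w dw G γ θ x₁ N (fun k => blk k ω) (fun k => ξ k ω)) - f y ≥
        b * (∑ k ∈ Finset.Icc 1 N, θ k)⁻¹ *
          (C * ∑ i, prox (w i) (dw i) (x₁ i) (y i)
            + (⨆ i, M i) ^ 2 * ∑ k ∈ Finset.Icc 1 N, γ k * θ k
            + l * ((⨆ i, M i) ^ 2 * ∑ k ∈ Finset.Icc 1 N, γ k * θ k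
              + (⨆ i, M i) * √(32 * ∑ i, spread (X i) (w i))
                * √(∑ k ∈ Finset.Icc 1 N, θ k ^ 2)))}
      ≤ Real.exp (-l ^ 2 / 3) + Real.exp (-l) := by
  have hΩ : Nonempty Ω := nonempty_of_isProbabilityMeasure P
  have hb0 : NeZero b := ⟨fun h => by subst h; exact (blk 0 hΩ.some).elim0⟩
  have hb : (0 : ℝ) < b := Nat.cast_pos.2 (NeZero.pos b)
  have hMm : ∀ i, M i ≤ ⨆ i, M i := le_ciSup (Set.finite_range M).bddAbove
  have hm : 0 < ⨆ i, M i := (hM (Fin.ofNat b 0)).trans_le (hMm _)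
  set m := ⨆ i, M i
  set D := ∑ i, spread (X i) (w i) with hD
  have hD0 : 0 ≤ D := Finset.sum_nonneg fun i _ =>
    (hw i).spread_nonneg (hXc i) (hX i) ⟨_, hy i trivial⟩
  have hθ0 : ∀ k < N, 0 < θ (k + 1) := fun k hk => by
    have hmem : k + 1 ∈ Finset.Icc 1 N := Finset.mem_Icc.2 ⟨by omega, hk⟩
    rw [hθ _ hmem]
    exact div_pos (hγ _ hmem) (hΓ _ hmem)
  have hγ0 : ∀ k < N, 0 < γ (k + 1) := fun k hk =>
    hγ _ (Finset.mem_Icc.2 ⟨by omega, hk⟩)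
  have hW : 0 < ∑ k ∈ Finset.Icc 1 N, θ k := by
    rw [sum_Icc_one_eq_sum_range]
    exact Finset.sum_pos (fun k hk => hθ0 k (Finset.mem_range.1 hk)) ⟨0, Finset.mem_range.2 hN⟩
  have hγθ : ∀ k < N, 0 < γ (k + 1) * θ (k + 1) := fun k hk => mul_pos (hγ0 k hk) (hθ0 k hk)
  have hW2 : 0 < ∑ k ∈ Finset.range N, γ (k + 1) * θ (k + 1) :=
    Finset.sum_pos (fun k hk => hγθ k (Finset.mem_range.1 hk)) ⟨0, Finset.mem_range.2 hN⟩
  have hθ2 : 0 < ∑ k ∈ Finset.range N, θ (k + 1) ^ 2 :=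
    Finset.sum_pos (fun k hk => pow_pos (hθ0 k (Finset.mem_range.1 hk)) 2)
      ⟨0, Finset.mem_range.2 hN⟩
  set r := m * √(8 * D) with hr
  have hr0 : 0 ≤ r := by positivity
  have hr2 : r ^ 2 = m ^ 2 * (8 * D) := by rw [hr, mul_pow, Real.sq_sqrt (by positivity)]
  let ζ : ℕ → Ω → Fin b × Ξ := fun k ω => (blk k ω, ξ k ω)
  let xs : ℕ → Ω → Set.univ.pi X := fun k ω =>
    feasibleRun hX hw G γ ⟨x₁, hx₁⟩ (fun j => ζ j ω) k
  have hζ : ∀ k ∈ Finset.Icc 1 N, Measurable (ζ k) := fun k hk =>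
    (hsample.measurable_blk k hk).prodMk (hsample.measurable_sample k hk)
  have hlaw : ∀ k ∈ Finset.Icc 1 N, P.map (ζ k) = sampleLaw b ν := fun k hk =>
    hsample.map_pair hk
  have hΦ : ∀ k < N, Measurable (feasibleStep hX hw G (γ (k + 1))) := fun k _ =>
    measurable_feasibleStep hXc hX hw hG.measurable _
  have hind := indepFun_of_recursion (x := xs) hζ hsample.indep hΦ (x₀ := ⟨x₁, hx₁⟩)
    (fun _ => rfl) (fun _ _ _ => rfl)
  have hpair : ∀ k < N, Measurable fun ω => (xs k ω, ζ (k + 1) ω) := fun k hk =>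
    (hind k hk).1.prodMk (hζ _ (Finset.mem_Icc.2 ⟨by omega, hk⟩))
  have hslope := measurable_slope (X := X) hG.measurable y
  have hnoise := measurable_noise (X := X) hG.measurable m
  have hnoise0 : ∀ p : Set.univ.pi X × (Fin b × Ξ), 0 ≤ noise G m p := fun p => by
    unfold noise; positivity
  have hexp := lintegral_exp_noise_le hG.measurable hM htail hMm
  have hsq : ∀ p, slope G y p ^ 2 ≤ r ^ 2 * noise G m p := fun p => by
    rw [hr2]; exact sq_slope_le hXc hX hw hm hy p
  -- Written with the integral rather than with `g`, so that measurability follows from that of the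
  -- oracle.
  let d : Set.univ.pi X × (Fin b × Ξ) → ℝ := fun p =>
    (∫ z, slope G y (p.1, z) ∂(sampleLaw b ν)) - slope G y p
  have hd : Measurable d :=
    (hslope.stronglyMeasurable.integral_prod_right'.measurable.comp measurable_fst).sub hslope
  have hdeq : ∀ p, d p = (b : ℝ)⁻¹ * pairing (g p.1.1) (p.1.1 - y) - slope G y p := fun p => by
    have hi := (integral_sq_le_of_exp (hslope.comp measurable_prodMk_left)
      (hnoise.comp measurable_prodMk_left) (fun z => hnoise0 (p.1, z))
      (fun z => hsq (p.1, z)) (hexp p.1)).1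
    simp only [d]
    rw [integral_slope hG y p.1 hi]
  set A : Ω → ℝ := fun ω => ∑ k ∈ Finset.range N,
    γ (k + 1) * θ (k + 1) * noise G m (xs k ω, ζ (k + 1) ω) with hA
  set B : Ω → ℝ := fun ω => ∑ k ∈ Finset.range N, θ (k + 1) * d (xs k ω, ζ (k + 1) ω) with hB
  have hBm : Measurable B := Finset.measurable_fun_sum _ fun k hk =>
    (hd.comp (hpair k (Finset.mem_range.1 hk))).const_mul _
  set v := r ^ 2 * ∑ k ∈ Finset.range N, θ (k + 1) ^ 2 with hv
  have hv0 : 0 ≤ v := by positivity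
  have hPA : P.real {ω | (1 + l) * ∑ k ∈ Finset.range N, γ (k + 1) * θ (k + 1) ≤ A ω}
      ≤ Real.exp (-l) :=
    measureReal_weighted_sum_ge_le (fun k hk => hnoise.comp (hpair k hk)) (fun k hk => by
      have hmem : k + 1 ∈ Finset.Icc 1 N := Finset.mem_Icc.2 ⟨by omega, hk⟩
      have h := lintegral_comp_le_of_indepFun (hind k hk).1 (hζ _ hmem) (hind k hk).2
        (hlaw _ hmem) (F := fun s z => ENNReal.ofReal (Real.exp (noise G m (s, z))))
        (H := fun _ => ENNReal.ofReal (Real.exp 1)) (by fun_prop) hexp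
      simpa using h) (fun k hk => (hγθ k hk).le) hW2 l
  have hPB : P.real {ω | l * (2 * √v) < B ω} ≤ Real.exp (-l ^ 2 / 3) := by
    -- If v = 0 then every slope vanishes and B = 0. The strict inequality makes the event empty
    -- here.
    rcases hv0.eq_or_lt with h0 | hvpos
    · have hr00 : r ^ 2 = 0 := by
        rcases mul_eq_zero.1 (hv ▸ h0.symm) with h | h
        · exact h
        · exact absurd h hθ2.ne'
      have hs0 : ∀ p, slope (X := X) G y p = 0 := fun p => by
        have := hsq p
        rw [hr00, zero_mul] at this
        exact pow_eq_zero_iff (two_ne_zero) |>.1 (le_antisymm this (sq_nonneg _))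
      have : {ω | l * (2 * √v) < B ω} = ∅ := by
        refine Set.eq_empty_of_forall_notMem fun ω h => ?_
        rw [Set.mem_ofPred_eq] at h
        simp [B, d, hs0, ← h0] at h
      rw [this, measureReal_empty]
      exact (Real.exp_pos _).le
    · refine measureReal_subGaussian_gt_le hBm hvpos (fun t => ?_) hl
      have h := lintegral_exp_sum_le hζ hsample.indep hlaw (x := xs) hΦ (x₀ := ⟨x₁, hx₁⟩)
        (fun _ => rfl) (fun _ _ _ => rfl) hd (fun k => t * θ (k + 1))
        (fun k => 3 * (t * θ (k + 1)) ^ 2 * r ^ 2)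
        (fun k _ s => lintegral_exp_centered_le (hslope.comp measurable_prodMk_left)
          (hnoise.comp measurable_prodMk_left) (fun z => hnoise0 (s, z)) hr0
          (fun z => hsq (s, z)) (hexp s) _) N le_rfl
      have e1 : ∑ k ∈ Finset.range N, 3 * (t * θ (k + 1)) ^ 2 * r ^ 2 = 3 * t ^ 2 * v := by
        rw [hv, Finset.mul_sum, Finset.mul_sum]
        exact Finset.sum_congr rfl fun k _ => by ring
      have e2 : ∀ ω, ∑ k ∈ Finset.range N, t * θ (k + 1) * d (xs k ω, ζ (k + 1) ω) = t * B ω :=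
        fun ω => by
          rw [hB, Finset.mul_sum]
          exact Finset.sum_congr rfl fun k _ => by ring
      simp_rw [e1, e2] at h
      exact h
  -- Only monotonicity and subadditivity are used, so the gap event need not be measurable. Off the
  -- union, the pathwise estimate contradicts the event.
  refine le_trans (measureReal_mono (s₂ := {ω | l * (2 * √v) < B ω} ∪
    {ω | (1 + l) * ∑ k ∈ Finset.range N, γ (k + 1) * θ (k + 1) ≤ A ω}) fun ω hω => ?_)
    ((measureReal_union_le _ _).trans (add_le_add hPB hPA))
  by_contra hcon
  rw [Set.mem_union, not_or, Set.mem_ofPred_eq, Set.mem_ofPred_eq, not_lt, not_le] at hcon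
  obtain ⟨hB', hA'⟩ := hcon
  rw [Set.mem_ofPred_eq] at hω
  have hgap := output_gap_le (G := G) (g := g) (θ := θ) hXc hX hw hf ⟨x₁, hx₁⟩ hN hγ hm hΓ hΓ1 hΓs
    hθ hC hy hsub (fun k => blk k ω) (fun k => ξ k ω)
  have hle := le_trans hω hgap
  rw [mul_le_mul_iff_right₀ (mul_pos hb (inv_pos.2 hW))] at hle
  have e3 : ∑ k ∈ Finset.range N, θ (k + 1) *
          ((b : ℝ)⁻¹ * pairing (g (xs k ω).1) ((xs k ω).1 - y)
          - slope G y (xs k ω, ζ (k + 1) ω)) = B ω :=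
    Finset.sum_congr rfl fun k _ => by rw [hdeq]
  have e4 : 2 * √v = m * √(32 * D) * √(∑ k ∈ Finset.Icc 1 N, θ k ^ 2) := by
    rw [hv, hr, Real.sqrt_mul (sq_nonneg _), Real.sqrt_sq hr0,
      sum_Icc_one_eq_sum_range (fun k => θ k ^ 2), show 32 * D = 2 ^ 2 * (8 * D) by ring,
      Real.sqrt_mul (by norm_num), Real.sqrt_sq (by norm_num)]
    ring
  rw [← e4, sum_Icc_one_eq_sum_range (fun k => γ k * θ k)] at hle
  change _ ≤ _ + 1 / 2 * (m ^ 2 * A ω) + ∑ k ∈ Finset.range N, θ (k + 1) *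
          ((b : ℝ)⁻¹ * pairing (g (xs k ω).1) ((xs k ω).1 - y)
          - slope G y (xs k ω, ζ (k + 1) ω)) at hle
  rw [e3] at hle
  have h5 := mul_lt_mul_of_pos_left hA' (pow_pos hm 2)
  have h6 : 0 < m ^ 2 * ((1 + l) * ∑ k ∈ Finset.range N, γ (k + 1) * θ (k + 1)) := by positivity
  simp only at hle
  linarith

end LargeDeviations

end SBMD

/-! ### Specialization to the two stepsize policies. -/

theorem mainTheorem3 {b : ℕ} {E : Fin b → Type*}
    [∀ i, NormedAddCommGroup (E i)] [∀ i, NormedSpace ℝ (E i)] [∀ i, FiniteDimensional ℝ (E i)]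
    [∀ i, MeasurableSpace (E i)] [∀ i, BorelSpace (E i)]
    {Ξ : Type*} [MeasurableSpace Ξ] (ν : Measure Ξ) [IsProbabilityMeasure ν]
    {Ω : Type*} [MeasurableSpace Ω] (P : Measure Ω) [IsProbabilityMeasure P]
    (X : ∀ i, Set (E i)) (hXclosed : ∀ i, IsClosed (X i)) (hXconvex : ∀ i, Convex ℝ (X i))
    (hXbounded : ∀ i, Bornology.IsBounded (X i))
    (w : ∀ i, E i → ℝ) (dw : ∀ i, E i → StrongDual ℝ (E i))
    (hw : ∀ i, SBMD.IsDistanceGenerating (X i) (w i) (dw i))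
    (f : (∀ i, E i) → ℝ) (hf : ConvexOn ℝ (Set.univ.pi X) f)
    (g : (∀ i, E i) → ∀ i, StrongDual ℝ (E i))
    (G : (∀ i, E i) → Ξ → ∀ i, StrongDual ℝ (E i))
    (hG : SBMD.IsStochasticSubgradient X f g G ν)
    (M : Fin b → ℝ) (hM : ∀ i, 0 < M i) (htail : SBMD.LightTail X G ν M)
    (x₁ : ∀ i, E i) (hx₁ : x₁ ∈ Set.univ.pi X)
    (N : ℕ) (hN : 1 ≤ N)
    (blk : ℕ → Ω → Fin b) (ξ : ℕ → Ω → Ξ) (hsample : SBMD.IsUniformSampling P ν N blk ξ)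
    (γ θ : ℕ → ℝ) (hγ : ∀ k ∈ Finset.Icc 1 N, 0 < γ k) :
    ((∀ k ∈ Finset.Icc 1 N, θ k = γ k) →
      ∀ x ∈ Set.univ.pi X, ∀ l : ℝ, 0 < l →
        P.real {ω |
          f (SBMD.output X w dw G γ θ x₁ N (fun k => blk k ω) (fun k => ξ k ω)) - f x ≥
            b * (∑ k ∈ Finset.Icc 1 N, γ k)⁻¹ *
              (∑ i, SBMD.prox (w i) (dw i) (x₁ i) (x i)
                + (⨆ i, M i) ^ 2 * ∑ k ∈ Finset.Icc 1 N, γ k ^ 2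
                + l * ((⨆ i, M i) ^ 2 * ∑ k ∈ Finset.Icc 1 N, γ k ^ 2
                  + (⨆ i, M i) * √(32 * ∑ i, SBMD.spread (X i) (w i))
                    * √(∑ k ∈ Finset.Icc 1 N, γ k ^ 2)))}
          ≤ Real.exp (-l ^ 2 / 3) + Real.exp (-l)) ∧
    (∀ μ Q : ℝ, 0 < μ → 0 < Q →
      SBMD.IsStronglyConvex X f g μ →
      (∀ i, ∀ z ∈ X i, ∀ x ∈ X i, SBMD.prox (w i) (dw i) z x ≤ Q / 2 * ‖z - x‖ ^ 2) →
      (∀ k ∈ Finset.Icc 1 N, γ k ≤ b * Q / μ) →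
      (∀ k ∈ Finset.Icc 1 N, 0 < SBMD.Gam b μ Q γ k) →
      (∀ k ∈ Finset.Icc 1 N, θ k = γ k / SBMD.Gam b μ Q γ k) →
      ∀ x ∈ Set.univ.pi X, ∀ l : ℝ, 0 < l →
        P.real {ω |
          f (SBMD.output X w dw G γ θ x₁ N (fun k => blk k ω) (fun k => ξ k ω)) - f x ≥
            b * (∑ k ∈ Finset.Icc 1 N, θ k)⁻¹ *
              ((b - γ 1 * μ / Q) * ∑ i, SBMD.prox (w i) (dw i) (x₁ i) (x i)
                + (⨆ i, M i) ^ 2 * ∑ k ∈ Finset.Icc 1 N, γ k * θ k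
                + l * ((⨆ i, M i) ^ 2 * ∑ k ∈ Finset.Icc 1 N, γ k * θ k
                  + (⨆ i, M i) * √(32 * ∑ i, SBMD.spread (X i) (w i))
                    * √(∑ k ∈ Finset.Icc 1 N, θ k ^ 2)))}
          ≤ Real.exp (-l ^ 2 / 3) + Real.exp (-l)) := by
  have hX : ∀ i, IsCompact (X i) := fun i =>
    Metric.isCompact_of_isClosed_isBounded (hXclosed i) (hXbounded i)
  have hΩ : Nonempty Ω := nonempty_of_isProbabilityMeasure P
  have hb0 : NeZero b := ⟨fun h => by subst h; exact (blk 0 hΩ.some).elim0⟩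
  have hb : (1 : ℝ) ≤ b := Nat.one_le_cast.2 (NeZero.pos b)
  have hneg : ∀ x y, SBMD.pairing (g x) (x - y) = -SBMD.pairing (g x) (y - x) := fun x y => by
    simp only [SBMD.pairing, ← Finset.sum_neg_distrib, ← map_neg, Pi.sub_apply, neg_sub]
  refine ⟨fun hθ y hy l hl => ?_, fun μ Q hμ hQ hf' hV hγQ hΓ hθ y hy l hl => ?_⟩
  · have h := SBMD.measureReal_output_gap_ge_le (θ := θ) (Γ := fun _ => 1) (κ := 0) (C := 1)
      hXconvex hX hw hf hG hM htail hx₁ hN hsample hγ (fun _ _ => one_pos) rfl (fun k _ => by simp)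
      (fun k hk => by rw [hθ k hk, div_one]) (by simp) hy
      (fun x hx => by
        have := hG.subgradient x hx y hy
        rw [hneg]
        linarith) hl
    rw [one_mul, Finset.sum_congr rfl hθ,
      Finset.sum_congr rfl (fun k hk => by rw [hθ k hk, ← sq] :
        ∀ k ∈ Finset.Icc 1 N, γ k * θ k = γ k ^ 2),
      Finset.sum_congr rfl (fun k hk => by rw [hθ k hk] :
        ∀ k ∈ Finset.Icc 1 N, θ k ^ 2 = γ k ^ 2)] at h
    exact h
  · have h1mem : 1 ∈ Finset.Icc 1 N := Finset.mem_Icc.2 ⟨le_rfl, hN⟩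
    refine SBMD.measureReal_output_gap_ge_le (Γ := SBMD.Gam b μ Q γ) (κ := μ / Q) hXconvex hX hw
      hf hG hM htail hx₁ hN hsample hγ hΓ rfl (fun k _ => ?_) hθ ?_ hy (fun x hx => ?_) hl
    · rw [SBMD.Gam]
      congr 2
      field_simp
    · have h1 := hγQ 1 h1mem
      rw [le_div_iff₀ hμ] at h1
      -- The stated coefficient is b times the one from telescoping; it is larger because γ 1 ≤ bQ /
      -- μ keeps the factor nonnegative.
      have e : (b : ℝ) - γ 1 * μ / Q = b * (1 - γ 1 * (μ / Q) / b) := by field_simp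
      rw [e]
      refine le_mul_of_one_le_left ?_ hb
      have h2 : γ 1 * (μ / Q) / b = γ 1 * μ / (b * Q) := by field_simp
      rw [h2, sub_nonneg, div_le_one (by positivity)]
      exact h1
    · have h1 := hf' x hx y hy
      -- Quadratic growth V ≤ (Q/2)‖·‖² turns strong convexity in norm into strong convexity
      -- relative to V, with κ = μ / Q.
      have h2 : μ / Q * ∑ i, SBMD.prox (w i) (dw i) (x i) (y i)
          ≤ μ / 2 * ∑ i, ‖y i - x i‖ ^ 2 := by
        rw [Finset.mul_sum, Finset.mul_sum]
        refine Finset.sum_le_sum fun i _ => ?_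
        have h3 := mul_le_mul_of_nonneg_left (hV i (x i) (hx i trivial) (y i) (hy i trivial))
          (div_pos hμ hQ).le
        refine h3.trans (le_of_eq ?_)
        rw [norm_sub_rev]
        field_simp
      rw [hneg]
      linarith
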